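/- **Setting.** Consider $N$ players with states $x_t\in\mathbb R^{n_x}$, inputs $u_t^i\in\mathbb R^{n_u}$, horizon $T$ and dynamics $x_{t+1}=A_tx_t+\sum_i B_t^iu_t^i+w_t$, $0\le t<T$, where $x_0\sim\mathcal N(\mu_0,\chi_0)$ with $\chi_0\succ0$ and $w_t\sim\mathcal N(0,\Sigma_t)$ with $\Sigma_t\succeq 0$ are independent. Let $u_t^i=-K_t^ix_t-\alpha_t^i$ be affine feedback policies (for instance the feedback Nash equilibrium of a linear-quadratic Gaussian game) for which $F_t=A_t-\sum_jB_t^jK_t^j$ is invertible for all $0\le t<T$. **Identification algorithm.** Fix $\tau>0$. Given policies $(K,\alpha)$, the parameters $\theta_t^i=[\operatorname{vec}(Q_t^i)^\top,(l_t^i)^\top,\operatorname{vec}(R_{t-1}^i)^\top,1]^\top$ are computed for $t=T,T-1,\dots,1$ as follows. Put $\Delta_T^i=0$, $\Omega_T^i=0$ and, for $t<T$, with $P_{t+1}^i=\Delta_{t+1}^i+Q_{t+1}^i$ and $\zeta_{t+1}^i=\Omega_{t+1}^i+l_{t+1}^i$, $$\Delta_t^i=F_t^\top P_{t+1}^iF_t+K_t^{i\top}R_t^iK_t^i,\qquad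 \Omega_t^i=F_t^\top\Big(\zeta_{t+1}^i-P_{t+1}^i\sum_jB_t^j\alpha_t^j\Big)+K_t^{i\top}R_t^i\alpha_t^i .$$ With $S_t^i=F_t^\top\otimes B_t^{i\top}$ and $E_t^i=K_t^iF_t^{-1}\sum_jB_t^j\alpha_t^j+\alpha_t^i$, let $$M_t^i=\begin{bmatrix}S_{t-1}^i&0&-K_{t-1}^{i\top}\otimes I&S_{t-1}^i\operatorname{vec}(\Delta_t^i)\\0&B_{t-1}^{i\top}&-E_{t-1}^{i\top}\otimes I&B_{t-1}^{i\top}\Omega_t^i\end{bmatrix},$$ and let $\theta_t^i$ be a minimizer of $\|M_t^i\theta\|_2^2$ over all $\theta$ whose last entry is $1$, whose $R$-part is diagonal, and which satisfy $D\theta\ge\tau$ entrywise, where $D$ selects all entries of $Q$ and $l$ and the diagonal entries of $R$. The active set of $\theta$ is $\mathcal A(\theta)=\{j:(D\theta)_j=\tau\}$. If several minimizers have the same active set, the one of least Euclidean norm among them is taken. **Estimation.** Let $n$ independent trajectories $(x_t^{(s)})_t$ be generated under $(K,\alpha)$, and let the inputs be observed as $u_t^{i(s)}=-K_t^ix_t^{(s)}-\alpha_t^i+\nu_t^{i(s)}$,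 where the noises $\nu_t^{i(s)}$ are centred, entrywise sub-Gaussian with a fixed variance proxy $\sigma^2$, independent of the initial states and the system noise, and independent across $s$. Let $[\widehat K_t^i,\widehat\alpha_t^i]$ minimize $\sum_{s=1}^n\|Kx_t^{(s)}+\alpha+u_t^{i(s)}\|_2^2$, and let $\widehat\theta_t^i$, $\widehat M_t^i$ be obtained by running the algorithm on $(\widehat K,\widehat\alpha)$. **Theorem.** Let $\theta_t^i$ be obtained by running the algorithm on $(K,\alpha)$. There are constants $c_1,c_2,C,\varepsilon_0>0$, depending only on the dynamics, $(K,\alpha)$, $T$, $\mu_0,\chi_0,\Sigma_t$, $\sigma^2$, $\tau$ and $\theta$, such that with $$n(\varepsilon,\delta)=\max\Big\{\tfrac{c_1}{\varepsilon^{2}}\log\tfrac{2(n_x+1)}{\delta},\;c_2\log\tfrac{2(n_x+1)}{\delta}\Big\}$$ the following holds for all $\varepsilon>0$, $\delta\in(0,1)$ and $n\ge n(\varepsilon,\delta)$. 1. For all $0\le t<T$ and all $i$, $\ \mathbb P\big(\|[\widehat K_t^i,\widehat\alpha_t^i]-[K_t^i,\alpha_t^i]\|\le\varepsilon\big)\ge1-\delta$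 (Frobenius norm). 2. If $\varepsilon\le\varepsilon_0$, then for all $1\le t\le T$ and all $i$, with probability at least $(1-\delta)^{T-t+1}$, $$\|\widehat\theta_t^i-\theta_t^i\|_2\le C\varepsilon$$ holds whenever, for all $1\le r\le T$ and all $j$, $\mathcal A(\widehat\theta_r^j)=\mathcal A(\theta_r^j)$ and the submatrices of $\widehat M_r^j$ and $M_r^j$ formed by the columns of the free entries (those selected by $D$ whose constraint is inactive) have the same rank. In particular, if these conditions hold almost surely, then $\mathbb P(\|\widehat\theta_t^i-\theta_t^i\|_2\le C\varepsilon)\ge(1-\delta)^{T-t+1}$. -/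

import Mathlib

open MeasureTheory ProbabilityTheory Matrix
open scoped Kronecker NNReal

noncomputable section

/-- Linear dynamics `x_{t+1} = A_t x_t + ∑ᵢ B_tⁱ u_tⁱ + w_t` with `N` players. -/
structure LinearDynamics (N nx nu : ℕ) where
  A : ℕ → Matrix (Fin nx) (Fin nx) ℝ
  B : ℕ → Fin N → Matrix (Fin nx) (Fin nu) ℝ

/-- A profile of affine state-feedback policies `u_tⁱ = - K_tⁱ x_t - α_tⁱ`. -/
structure AffinePolicy (N nx nu : ℕ) where
  K : ℕ → Fin N → Matrix (Fin nu) (Fin nx) ℝ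
  α : ℕ → Fin N → Fin nu → ℝ

/-- Entries of `θ = [vec Q, l, vec R, 1]`; a matrix entry in row `a` and column `b` has the index
`(b, a)`, as in `Matrix.vec`. -/
abbrev ParamIdx (nx nu : ℕ) : Type :=
  (Fin nx × Fin nx) ⊕ (Fin nx ⊕ ((Fin nu × Fin nu) ⊕ Unit))

/-- Rows of the selector matrix: the entries of `Q`, those of `l`, and the diagonal of `R`. -/
abbrev ConstrIdx (nx nu : ℕ) : Type := (Fin nx × Fin nx) ⊕ (Fin nx ⊕ Fin nu)

section Identification

variable {N nx nu : ℕ}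

def paramQ (θ : ParamIdx nx nu → ℝ) : Matrix (Fin nx) (Fin nx) ℝ :=
  Matrix.of fun a b => θ (Sum.inl (b, a))

def paramL (θ : ParamIdx nx nu → ℝ) : Fin nx → ℝ :=
  fun a => θ (Sum.inr (Sum.inl a))

def paramR (θ : ParamIdx nx nu → ℝ) : Matrix (Fin nu) (Fin nu) ℝ :=
  Matrix.of fun a b => θ (Sum.inr (Sum.inr (Sum.inl (b, a))))

/-- Closed-loop matrix `F_t = A_t - ∑ⱼ B_tʲ K_tʲ`. -/
def closedLoop (dyn : LinearDynamics N nx nu) (pol : AffinePolicy N nx nu) (t : ℕ) :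
    Matrix (Fin nx) (Fin nx) ℝ :=
  dyn.A t - ∑ j, dyn.B t j * pol.K t j

/-- `∑ⱼ B_tʲ α_tʲ`. -/
def drift (dyn : LinearDynamics N nx nu) (pol : AffinePolicy N nx nu) (t : ℕ) : Fin nx → ℝ :=
  ∑ j, dyn.B t j *ᵥ pol.α t j

/-- `S_tⁱ = F_tᵀ ⊗ (B_tⁱ)ᵀ`. -/
def matS (dyn : LinearDynamics N nx nu) (pol : AffinePolicy N nx nu) (t : ℕ) (i : Fin N) :
    Matrix (Fin nx × Fin nu) (Fin nx × Fin nx) ℝ :=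
  (closedLoop dyn pol t)ᵀ ⊗ₖ (dyn.B t i)ᵀ

/-- `E_tⁱ = K_tⁱ F_t⁻¹ ∑ⱼ B_tʲ α_tʲ + α_tⁱ`. -/
def vecE (dyn : LinearDynamics N nx nu) (pol : AffinePolicy N nx nu) (t : ℕ) (i : Fin N) :
    Fin nu → ℝ :=
  (pol.K t i * (closedLoop dyn pol t)⁻¹) *ᵥ drift dyn pol t + pol.α t i

/-- The matrix `Δ_{T-k}ⁱ`: `Δ_T = 0` and `Δ_t = F_tᵀ P_{t+1} F_t + K_tᵀ R_t K_t`, where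
`P_{t+1} = Δ_{t+1} + Q_{t+1}` and where `Q_{t+1}` and `R_t` are entries of `θ_{t+1}`. -/
def deltaBack (T : ℕ) (dyn : LinearDynamics N nx nu) (pol : AffinePolicy N nx nu)
    (θ : ℕ → Fin N → ParamIdx nx nu → ℝ) (i : Fin N) : ℕ → Matrix (Fin nx) (Fin nx) ℝ
  | 0 => 0
  | k + 1 =>
    let t := T - (k + 1)
    (closedLoop dyn pol t)ᵀ * (deltaBack T dyn pol θ i k + paramQ (θ (t + 1) i)) *
        closedLoop dyn pol t
      + (pol.K t i)ᵀ * paramR (θ (t + 1) i) * pol.K t i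

/-- The vector `Ω_{T-k}ⁱ`: `Ω_T = 0` and
`Ω_t = F_tᵀ (ζ_{t+1} - P_{t+1} ∑ⱼ B_tʲ α_tʲ) + K_tᵀ R_t α_t`, where `ζ_{t+1} = Ω_{t+1} + l_{t+1}`
and `P_{t+1} = Δ_{t+1} + Q_{t+1}`. -/
def omegaBack (T : ℕ) (dyn : LinearDynamics N nx nu) (pol : AffinePolicy N nx nu)
    (θ : ℕ → Fin N → ParamIdx nx nu → ℝ) (i : Fin N) : ℕ → Fin nx → ℝ
  | 0 => 0
  | k + 1 =>
    let t := T - (k + 1)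
    (closedLoop dyn pol t)ᵀ *ᵥ
        (omegaBack T dyn pol θ i k + paramL (θ (t + 1) i)
          - (deltaBack T dyn pol θ i k + paramQ (θ (t + 1) i)) *ᵥ drift dyn pol t)
      + ((pol.K t i)ᵀ * paramR (θ (t + 1) i)) *ᵥ pol.α t i

/-- The matrix `M_tⁱ` for `1 ≤ t ≤ T`. It depends on `θ` only through `θ_{t+1}, …, θ_T`. -/
def matM (T : ℕ) (dyn : LinearDynamics N nx nu) (pol : AffinePolicy N nx nu)
    (θ : ℕ → Fin N → ParamIdx nx nu → ℝ) (t : ℕ) (i : Fin N) :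
    Matrix ((Fin nx × Fin nu) ⊕ Fin nu) (ParamIdx nx nu) ℝ :=
  Matrix.fromRows
    (Matrix.fromCols (matS dyn pol (t - 1) i)
      (Matrix.fromCols 0
        (Matrix.fromCols (-((pol.K (t - 1) i)ᵀ ⊗ₖ (1 : Matrix (Fin nu) (Fin nu) ℝ)))
          (Matrix.replicateCol Unit
            (matS dyn pol (t - 1) i *ᵥ (deltaBack T dyn pol θ i (T - t)).vec)))))
    (Matrix.fromCols 0
      (Matrix.fromCols (dyn.B (t - 1) i)ᵀ
        (Matrix.fromCols
          (-Matrix.of fun k q => vecE dyn pol (t - 1) i q.1 * (1 : Matrix (Fin nu) (Fin nu) ℝ) k q.2)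
          (Matrix.replicateCol Unit
            ((dyn.B (t - 1) i)ᵀ *ᵥ omegaBack T dyn pol θ i (T - t))))))

/-- The entry of `θ` selected by a row of the selector matrix. -/
def selected : ConstrIdx nx nu → ParamIdx nx nu
  | Sum.inl q => Sum.inl q
  | Sum.inr (Sum.inl a) => Sum.inr (Sum.inl a)
  | Sum.inr (Sum.inr a) => Sum.inr (Sum.inr (Sum.inl (a, a)))

/-- The selector matrix `D`. -/
def selectorD (nx nu : ℕ) : Matrix (ConstrIdx nx nu) (ParamIdx nx nu) ℝ :=
  Matrix.of fun j p => if selected j = p then 1 else 0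

/-- Feasible points of the least-squares problem: `D θ ≥ τ` entrywise, and the known entries of `θ`
have their values, that is, `R` has zero off-diagonal entries and the last entry is `1`. -/
def IsFeasible (τ : ℝ) (θ : ParamIdx nx nu → ℝ) : Prop :=
  (∀ j, τ ≤ (selectorD nx nu *ᵥ θ) j) ∧
  (∀ a b, a ≠ b → paramR θ a b = 0) ∧
  θ (Sum.inr (Sum.inr (Sum.inr ()))) = 1

/-- `θ` solves `min ‖M θ‖²` subject to feasibility. -/
def IsLSSolution (τ : ℝ) (M : Matrix ((Fin nx × Fin nu) ⊕ Fin nu) (ParamIdx nx nu) ℝ)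
    (θ : ParamIdx nx nu → ℝ) : Prop :=
  IsFeasible τ θ ∧ ∀ θ', IsFeasible τ θ' →
    ‖WithLp.toLp 2 (M *ᵥ θ)‖ ^ 2 ≤ ‖WithLp.toLp 2 (M *ᵥ θ')‖ ^ 2

/-- Indices of the constraints `D θ ≥ τ` that hold with equality. -/
def activeSet (τ : ℝ) (θ : ParamIdx nx nu → ℝ) : Set (ConstrIdx nx nu) :=
  {j | (selectorD nx nu *ᵥ θ) j = τ}

/-- Convention for rank-deficient problems: among the solutions with a given active set (there may
be a continuum of them), the one of least Euclidean norm is returned. The least-norm solution of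
the whole problem has this property, and so has every solution that is the only one with its
active set. -/
def IsReturnedSolution (τ : ℝ) (M : Matrix ((Fin nx × Fin nu) ⊕ Fin nu) (ParamIdx nx nu) ℝ)
    (θ : ParamIdx nx nu → ℝ) : Prop :=
  IsLSSolution τ M θ ∧ ∀ θ', IsLSSolution τ M θ' → activeSet τ θ' = activeSet τ θ →
    ‖WithLp.toLp 2 θ‖ ≤ ‖WithLp.toLp 2 θ'‖

/-- `θ_tⁱ`, `1 ≤ t ≤ T`, are the parameters found by the backward algorithm for the policy `pol`. -/
def IsIdentified (T : ℕ) (τ : ℝ) (dyn : LinearDynamics N nx nu) (pol : AffinePolicy N nx nu)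
    (θ : ℕ → Fin N → ParamIdx nx nu → ℝ) : Prop :=
  ∀ t, 1 ≤ t → t ≤ T → ∀ i, IsReturnedSolution τ (matM T dyn pol θ t i) (θ t i)

open Classical in
/-- Rank of the submatrix of `M` formed by the columns of the entries of `θ` that are free, that is,
selected by `D` with an inactive constraint. (The other columns of `M * Dᵀ` are set to zero.) -/
def freeRank (τ : ℝ) (M : Matrix ((Fin nx × Fin nu) ⊕ Fin nu) (ParamIdx nx nu) ℝ)
    (θ : ParamIdx nx nu → ℝ) : ℕ :=
  (M * (selectorD nx nu)ᵀ *
    Matrix.diagonal fun j => if j ∈ activeSet τ θ then (0 : ℝ) else 1).rank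

open scoped Matrix.Norms.Frobenius in
/-- Frobenius norm `‖[K̂_tⁱ, α̂_tⁱ] - [K_tⁱ, α_tⁱ]‖`. -/
def policyError (pol' pol : AffinePolicy N nx nu) (t : ℕ) (i : Fin N) : ℝ :=
  ‖Matrix.fromCols (pol'.K t i) (Matrix.replicateCol Unit (pol'.α t i))
    - Matrix.fromCols (pol.K t i) (Matrix.replicateCol Unit (pol.α t i))‖

end Identification

section Trajectories

variable {N nx nu : ℕ}

/-- The state `x_t` when all players apply `pol`, started at `x₀` and driven by the noise `w`. -/
def stateTraj (dyn : LinearDynamics N nx nu) (pol : AffinePolicy N nx nu)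
    (x₀ : Fin nx → ℝ) (w : ℕ → Fin nx → ℝ) : ℕ → Fin nx → ℝ
  | 0 => x₀
  | t + 1 =>
    dyn.A t *ᵥ stateTraj dyn pol x₀ w t
      + ∑ i, dyn.B t i *ᵥ (-(pol.K t i *ᵥ stateTraj dyn pol x₀ w t) - pol.α t i)
      + w t

/-- `(K, α)` minimizes `∑ₛ ‖K x⁽ˢ⁾ + α + u⁽ˢ⁾‖²`. -/
def IsRegression {n : ℕ} (x : Fin n → Fin nx → ℝ) (u : Fin n → Fin nu → ℝ)
    (K : Matrix (Fin nu) (Fin nx) ℝ) (α : Fin nu → ℝ) : Prop :=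
  ∀ (K' : Matrix (Fin nu) (Fin nx) ℝ) (α' : Fin nu → ℝ),
    ∑ s, ‖WithLp.toLp 2 (K *ᵥ x s + α + u s)‖ ^ 2
      ≤ ∑ s, ‖WithLp.toLp 2 (K' *ᵥ x s + α' + u s)‖ ^ 2

/-- `n` independent demonstrations over the horizon `T`: in each of them the initial state and the
system noises are independent Gaussians, and the input observation noises `ν_tⁱ` are centred
sub-Gaussian (entrywise, with variance proxy `σ2`; this implies mean zero) and independent of the
initial state and the system noise. The observation noises of one demonstration may depend on each
other in any way. -/
structure DemonstrationNoise {Ω : Type*} [MeasurableSpace Ω] (P : Measure Ω) (T n : ℕ)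
    (μ₀ : EuclideanSpace ℝ (Fin nx)) (χ₀ : Matrix (Fin nx) (Fin nx) ℝ)
    (Sig : ℕ → Matrix (Fin nx) (Fin nx) ℝ) (σ2 : ℝ≥0)
    (x₀ : Fin n → Ω → EuclideanSpace ℝ (Fin nx))
    (w : Fin n → ℕ → Ω → EuclideanSpace ℝ (Fin nx))
    (ν : Fin n → ℕ → Fin N → Ω → Fin nu → ℝ) : Prop where
  law_init : ∀ s, HasLaw (x₀ s) (multivariateGaussian μ₀ χ₀) P
  law_noise : ∀ s, ∀ t < T, HasLaw (w s t) (multivariateGaussian 0 (Sig t)) P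
  measurable_obs : ∀ s, ∀ t < T, ∀ i, Measurable (ν s t i)
  subgaussian_obs : ∀ s, ∀ t < T, ∀ i k, HasSubgaussianMGF (fun ω => ν s t i ω k) σ2 P
  indep_samples : iIndepFun (fun s ω =>
    (x₀ s ω, (fun t : Fin T => w s t ω), (fun (t : Fin T) (i : Fin N) => ν s t i ω))) P
  indep_noise : ∀ s, iIndepFun (fun (t : Fin T) ω => w s t ω) P
  indep_init : ∀ s, IndepFun (x₀ s) (fun ω (t : Fin T) => w s t ω) P
  indep_obs : ∀ s, IndepFun (fun ω (t : Fin T) (i : Fin N) => ν s t i ω)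
    (fun ω => (x₀ s ω, fun t : Fin T => w s t ω)) P

/-- The state `x_t⁽ˢ⁾` of a demonstration. -/
def demoState {Ω : Type*} {n : ℕ} (dyn : LinearDynamics N nx nu) (pol : AffinePolicy N nx nu)
    (x₀ : Fin n → Ω → EuclideanSpace ℝ (Fin nx))
    (w : Fin n → ℕ → Ω → EuclideanSpace ℝ (Fin nx)) (ω : Ω) (t : ℕ) (s : Fin n) : Fin nx → ℝ :=
  stateTraj dyn pol (x₀ s ω).ofLp (fun r => (w s r ω).ofLp) t

/-- The observed input `u_tⁱ⁽ˢ⁾ = - K_tⁱ x_t⁽ˢ⁾ - α_tⁱ + ν_tⁱ⁽ˢ⁾`. -/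
def demoInput {Ω : Type*} {n : ℕ} (dyn : LinearDynamics N nx nu) (pol : AffinePolicy N nx nu)
    (x₀ : Fin n → Ω → EuclideanSpace ℝ (Fin nx))
    (w : Fin n → ℕ → Ω → EuclideanSpace ℝ (Fin nx))
    (ν : Fin n → ℕ → Fin N → Ω → Fin nu → ℝ) (ω : Ω) (t : ℕ) (i : Fin N) (s : Fin n) :
    Fin nu → ℝ :=
  -(pol.K t i *ᵥ demoState dyn pol x₀ w ω t s) - pol.α t i + ν s t i ω

/-- `good` holds with probability at least `p`: it holds on a measurable event of at least this
probability. -/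
def HoldsWithProb {Ω : Type*} [MeasurableSpace Ω] (P : Measure Ω) (p : ℝ) (good : Ω → Prop) :
    Prop :=
  ∃ E : Set Ω, MeasurableSet E ∧ p ≤ P.real E ∧ ∀ ω ∈ E, good ω

/-- Sample size `n(ε, δ) = max {c₁ ε⁻² log (2 p / δ), c₂ log (2 p / δ)}` for a regression with `p`
regressors. -/
def sampleSize (c₁ c₂ : ℝ) (p : ℕ) (ε δ : ℝ) : ℝ :=
  max (c₁ / ε ^ 2 * Real.log (2 * p / δ)) (c₂ * Real.log (2 * p / δ))

end Trajectories

end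

/-!
Near the true policies the matrices `M_tⁱ` depend differentiably on the policy and on the parameters
of the later stages. Once the active set is fixed, the returned parameters are the least-norm
solution of an unconstrained least-squares problem in the free entries, and such solutions are
Lipschitz in the data as long as the rank does not change. A backward induction on the stage
therefore turns an error `ε` in the policies into an error `O(ε)` in the parameters.

For the regression, the second moments of the regressor `(x, 1)`, divided by `‖(x, 1)‖²`, are
bounded, so Hoeffding's inequality applies to them although the states are unbounded. Their mean
is positive definite because `x_t` is an invertible affine image of the Gaussian `x₀`, and the
unnormalized Gram matrix dominates the normalized one. On the event where the Gram matrix is at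
least of order `n`, the error of the estimate is a linear form of squared length `O(1/n)` in the
observation noises, which are independent of the states; Fubini's theorem and the sub-Gaussian
tail bound finish the proof.
-/

open Asymptotics Filter Module
open scoped InnerProductSpace Topology

section Perturbation

variable {X : Type*} {l : Filter X} {g : X → ℝ}
variable {E F G : Type*} [NormedAddCommGroup E] [NormedAddCommGroup F] [NormedAddCommGroup G]

/-- Along the filter `l`, the family `f` differs from `a` by `O(g)`. With `g → 0` this is a local
Lipschitz condition, and it is stable under sums, products and inverses. -/
def DeviatesBy (l : Filter X) (g : X → ℝ) (f : X → E) (a : E) : Prop :=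
  (fun x => f x - a) =O[l] g

namespace DeviatesBy

variable {f f' : X → E} {a a' : E}

theorem const (a : E) : DeviatesBy l g (fun _ => a) a := by
  simpa only [DeviatesBy, sub_self] using isBigO_zero g l

theorem add (hf : DeviatesBy l g f a) (hf' : DeviatesBy l g f' a') :
    DeviatesBy l g (fun x => f x + f' x) (a + a') :=
  (IsBigO.add hf hf').congr_left fun _ => (add_sub_add_comm ..).symm

theorem neg (hf : DeviatesBy l g f a) : DeviatesBy l g (fun x => -f x) (-a) :=
  (IsBigO.neg_left hf).congr_left fun x => by rw [neg_sub_neg, neg_sub]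

theorem sub (hf : DeviatesBy l g f a) (hf' : DeviatesBy l g f' a') :
    DeviatesBy l g (fun x => f x - f' x) (a - a') :=
  (IsBigO.sub hf hf').congr_left fun _ => (sub_sub_sub_comm ..).symm

theorem sum {ι : Type*} {s : Finset ι} {f : ι → X → E} {a : ι → E}
    (hf : ∀ i ∈ s, DeviatesBy l g (f i) (a i)) :
    DeviatesBy l g (fun x => ∑ i ∈ s, f i x) (∑ i ∈ s, a i) :=
  (IsBigO.fun_sum hf).congr_left fun _ => Finset.sum_sub_distrib ..

theorem tendsto (hf : DeviatesBy l g f a) (hg : Tendsto g l (𝓝 0)) : Tendsto f l (𝓝 a) :=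
  tendsto_sub_nhds_zero_iff.1 (hf.trans_tendsto hg)

variable [NormedSpace ℝ E] [NormedSpace ℝ F] [NormedSpace ℝ G]

theorem map [FiniteDimensional ℝ E] (L : E →ₗ[ℝ] F) (hf : DeviatesBy l g f a) :
    DeviatesBy l g (fun x => L (f x)) (L a) :=
  ((L.toContinuousLinearMap.isBigO_comp _ l).trans hf).congr_left fun _ => map_sub L _ _

theorem map₂ [FiniteDimensional ℝ E] [FiniteDimensional ℝ F] (L : E →ₗ[ℝ] F →ₗ[ℝ] G)
    (hg : Tendsto g l (𝓝 0)) (hf : DeviatesBy l g f a) {h : X → F} {b : F}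
    (hh : DeviatesBy l g h b) : DeviatesBy l g (fun x => L (f x) (h x)) (L a b) := by
  have hbounded : h =O[l] (fun _ => (1 : ℝ)) := (hh.tendsto hg).isBigO_one ℝ
  let L' : E →L[ℝ] F →L[ℝ] G :=
    (LinearMap.toContinuousLinearMap.toLinearMap ∘ₗ L).toContinuousLinearMap
  have hleft : (fun x => L (f x - a) (h x)) =O[l] g :=
    (IsBigO.of_bound ‖L'‖ (Eventually.of_forall fun x => by
      simpa [L', mul_assoc] using L'.le_opNorm₂ (f x - a) (h x))).trans
        ((IsBigO.mul hf.norm_left hbounded.norm_left).congr_right fun _ => mul_one _)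
  exact (hleft.add (hh.map (L a))).congr_left fun x => by
    simp only [map_sub, LinearMap.sub_apply]; abel

theorem pi_iff {ι : Type*} [Fintype ι] {f : X → ι → ℝ} {a : ι → ℝ} :
    DeviatesBy l g f a ↔ ∀ i, DeviatesBy l g (fun x => f x i) (a i) :=
  isBigO_pi

theorem mul {f h : X → ℝ} {a b : ℝ} (hg : Tendsto g l (𝓝 0)) (hf : DeviatesBy l g f a)
    (hh : DeviatesBy l g h b) : DeviatesBy l g (fun x => f x * h x) (a * b) :=
  map₂ (LinearMap.mul ℝ ℝ) hg hf hh

open scoped Matrix.Norms.Frobenius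

variable {m n p q : Type*} [Fintype m] [Fintype n] [Fintype p] [Fintype q]

theorem matrix_iff {A : X → Matrix m n ℝ} {A₀ : Matrix m n ℝ} :
    DeviatesBy l g A A₀ ↔ ∀ i j, DeviatesBy l g (fun x => A x i j) (A₀ i j) := by
  refine ⟨fun h i j => h.map (Matrix.entryLinearMap ℝ ℝ i j), fun h => ?_⟩
  have hpi : DeviatesBy l g (fun x => Matrix.of.symm (A x)) (Matrix.of.symm A₀) :=
    isBigO_pi.2 fun i => isBigO_pi.2 fun j => h i j
  exact hpi.map (Matrix.ofLinearEquiv ℝ).toLinearMap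

variable {A : X → Matrix m n ℝ} {A₀ : Matrix m n ℝ}

theorem transpose (hA : DeviatesBy l g A A₀) : DeviatesBy l g (fun x => (A x)ᵀ) A₀ᵀ :=
  matrix_iff.2 fun i j => matrix_iff.1 hA j i

theorem matrix_mul (hg : Tendsto g l (𝓝 0)) (hA : DeviatesBy l g A A₀) {B : X → Matrix n p ℝ}
    {B₀ : Matrix n p ℝ} (hB : DeviatesBy l g B B₀) :
    DeviatesBy l g (fun x => A x * B x) (A₀ * B₀) :=
  map₂ (mulLinearMap ℝ) hg hA hB

theorem mulVec (hg : Tendsto g l (𝓝 0)) (hA : DeviatesBy l g A A₀) {v : X → n → ℝ} {v₀ : n → ℝ}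
    (hv : DeviatesBy l g v v₀) : DeviatesBy l g (fun x => A x *ᵥ v x) (A₀ *ᵥ v₀) :=
  map₂ (Matrix.mulVecBilin ℝ ℝ) hg hA hv

theorem kronecker (hg : Tendsto g l (𝓝 0)) (hA : DeviatesBy l g A A₀) {B : X → Matrix p q ℝ}
    {B₀ : Matrix p q ℝ} (hB : DeviatesBy l g B B₀) :
    DeviatesBy l g (fun x => A x ⊗ₖ B x) (A₀ ⊗ₖ B₀) :=
  matrix_iff.2 fun _ _ => mul hg (matrix_iff.1 hA _ _) (matrix_iff.1 hB _ _)

theorem vec (hA : DeviatesBy l g A A₀) : DeviatesBy l g (fun x => (A x).vec) A₀.vec :=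
  pi_iff.2 fun (i : n × m) => matrix_iff.1 hA i.2 i.1

theorem fromRows (hA : DeviatesBy l g A A₀) {B : X → Matrix p n ℝ} {B₀ : Matrix p n ℝ}
    (hB : DeviatesBy l g B B₀) :
    DeviatesBy l g (fun x => (A x).fromRows (B x)) (A₀.fromRows B₀) :=
  matrix_iff.2 fun i j => i.casesOn (matrix_iff.1 hA · j) (matrix_iff.1 hB · j)

theorem fromCols (hA : DeviatesBy l g A A₀) {B : X → Matrix m p ℝ} {B₀ : Matrix m p ℝ}
    (hB : DeviatesBy l g B B₀) :
    DeviatesBy l g (fun x => (A x).fromCols (B x)) (A₀.fromCols B₀) :=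
  matrix_iff.2 fun i j => j.casesOn (matrix_iff.1 hA i ·) (matrix_iff.1 hB i ·)

theorem replicateCol {v : X → m → ℝ} {v₀ : m → ℝ} (hv : DeviatesBy l g v v₀) :
    DeviatesBy l g (fun x => Matrix.replicateCol n (v x)) (Matrix.replicateCol n v₀) :=
  matrix_iff.2 fun i _ => pi_iff.1 hv i

theorem inv [DecidableEq n] (hg : Tendsto g l (𝓝 0)) {A : X → Matrix n n ℝ} {A₀ : Matrix n n ℝ}
    (hA : DeviatesBy l g A A₀) (hA₀ : IsUnit A₀) : DeviatesBy l g (fun x => (A x)⁻¹) A₀⁻¹ := by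
  have hdiff := (differentiableAt_inverse (𝕜 := ℝ) hA₀).isBigO_sub.comp_tendsto (hA.tendsto hg)
  simp only [Matrix.nonsing_inv_eq_ringInverse]
  exact hdiff.trans hA

end DeviatesBy

end Perturbation

section LeastSquares

variable {E F : Type*} [NormedAddCommGroup E] [InnerProductSpace ℝ E] [NormedAddCommGroup F]

theorem inner_eq_zero_of_eventually_norm_le {x y : E}
    (h : ∀ᶠ s in 𝓝 (0 : ℝ), ‖x‖ ≤ ‖x + s • y‖) : ⟪x, y⟫_ℝ = 0 := by
  have hderiv : HasDerivAt (fun s : ℝ => ‖x + s • y‖ ^ 2) (2 * ⟪x, y⟫_ℝ) 0 := by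
    simpa using (((hasDerivAt_id (0 : ℝ)).smul_const y).const_add x).norm_sq
  have hmin : IsLocalMin (fun s : ℝ => ‖x + s • y‖ ^ 2) 0 := by
    filter_upwards [h] with s hs
    simpa using pow_le_pow_left₀ (norm_nonneg x) hs 2
  simpa using hmin.hasDerivAt_eq_zero hderiv

theorem norm_le_of_sub_mem_of_mem_orthogonal {K : Submodule ℝ E} {x y : E} (hx : x ∈ Kᗮ)
    (hxy : x - y ∈ K) : ‖x‖ ≤ ‖y‖ := by
  have hpyth : ‖y‖ * ‖y‖ = ‖x‖ * ‖x‖ + ‖x - y‖ * ‖x - y‖ := by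
    simpa using norm_sub_sq_eq_norm_sq_add_norm_sq_real (K.inner_left_of_mem_orthogonal hxy hx)
  nlinarith [norm_nonneg x, norm_nonneg y, mul_self_nonneg ‖x - y‖]

section RankPersistence

variable [NormedSpace ℝ F] [FiniteDimensional ℝ E] {H H' : E →L[ℝ] F} {c ε : ℝ}

theorem exists_pos_mul_norm_le_of_mem_ker_orthogonal (H : E →L[ℝ] F) :
    ∃ c > 0, ∀ v ∈ H.kerᗮ, c * ‖v‖ ≤ ‖H v‖ := by
  have hker : LinearMap.ker (H.toLinearMap.domRestrict H.kerᗮ) = ⊥ := by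
    rw [LinearMap.ker_eq_bot, LinearMap.injective_domRestrict_iff]
    exact H.ker.orthogonal_disjoint.symm
  obtain ⟨K, hK, hanti⟩ := LinearMap.exists_antilipschitzWith _ hker
  refine ⟨(K : ℝ)⁻¹, inv_pos.2 hK, fun v hv => ?_⟩
  rw [inv_mul_le_iff₀ (NNReal.coe_pos.2 hK)]
  exact ZeroHomClass.bound_of_antilipschitz _ hanti ⟨v, hv⟩

theorem map_ker_orthogonal_eq_range_of_finrank_le
    (hrank : finrank ℝ H'.range ≤ finrank ℝ H.range) (hdisj : Disjoint H.kerᗮ H'.ker) :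
    H.kerᗮ.map H'.toLinearMap = H'.range := by
  refine Submodule.eq_of_le_of_finrank_le LinearMap.map_le_range (hrank.trans ?_)
  have hinj : Function.Injective (H'.toLinearMap.domRestrict H.kerᗮ) :=
    LinearMap.injective_domRestrict_iff.2 hdisj
  rw [← LinearMap.range_domRestrict, LinearMap.finrank_range_of_inj hinj]
  have := H.toLinearMap.finrank_range_add_finrank_ker
  have := H.ker.finrank_add_finrank_orthogonal
  lia

theorem mul_norm_le_of_finrank_range_le (hc : ∀ v ∈ H.kerᗮ, c * ‖v‖ ≤ ‖H v‖)
    (hε : ‖H' - H‖ ≤ ε) (hεc : ε < c) (hrank : finrank ℝ H'.range ≤ finrank ℝ H.range) :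
    ∀ v ∈ H'.kerᗮ, (c - ε) * ‖v‖ ≤ ‖H' v‖ := by
  have hlower : ∀ v ∈ H.kerᗮ, (c - ε) * ‖v‖ ≤ ‖H' v‖ := fun v hv => by
    have hdiff : ‖(H' - H) v‖ ≤ ε * ‖v‖ := (H' - H).le_of_opNorm_le hε v
    have htri : ‖H v‖ ≤ ‖H' v‖ + ‖(H' - H) v‖ := norm_le_norm_add_norm_sub _ _
    linarith [hc v hv]
  have hdisj : Disjoint H.kerᗮ H'.ker := by
    refine Submodule.disjoint_def.2 fun v hv hv' => norm_le_zero_iff.1 ?_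
    refine nonpos_of_mul_nonpos_right ((hlower v hv).trans_eq ?_) (sub_pos.2 hεc)
    exact norm_eq_zero.2 hv'
  intro v hv
  obtain ⟨y, hy, hyv⟩ : H' v ∈ H.kerᗮ.map H'.toLinearMap :=
    map_ker_orthogonal_eq_range_of_finrank_le hrank hdisj ▸ LinearMap.mem_range_self _ v
  have hvy : v - y ∈ H'.ker := LinearMap.sub_mem_ker_iff.2 hyv.symm
  calc (c - ε) * ‖v‖ ≤ (c - ε) * ‖y‖ :=
        mul_le_mul_of_nonneg_left (norm_le_of_sub_mem_of_mem_orthogonal hv hvy)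
          (sub_pos.2 hεc).le
    _ ≤ ‖H' y‖ := hlower y hy
    _ = ‖H' v‖ := congrArg norm hyv

theorem mul_norm_starProjection_ker_le (hc₀ : 0 ≤ c) (hc : ∀ v ∈ H.kerᗮ, c * ‖v‖ ≤ ‖H v‖) {x : E}
    (hx : x ∈ H.kerᗮ) : c * ‖H'.ker.starProjection x‖ ≤ ‖x‖ * ‖H' - H‖ := by
  set k := H'.ker.starProjection x
  have hk : H' k = 0 := H'.ker.starProjection_apply_mem x
  set r := k - H.ker.starProjection k
  have hr : c * ‖r‖ ≤ ‖H' - H‖ * ‖k‖ := by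
    have hHr : H r = -((H' - H) k) := by
      simp [r, hk, show H (H.ker.starProjection k) = 0 from H.ker.starProjection_apply_mem k]
    calc c * ‖r‖ ≤ ‖H r‖ := hc r (H.ker.sub_starProjection_mem_orthogonal k)
      _ ≤ ‖H' - H‖ * ‖k‖ := by rw [hHr, norm_neg]; exact (H' - H).le_opNorm k
  have hxk : ‖k‖ * ‖k‖ = ⟪x, r⟫_ℝ := by
    rw [inner_sub_right, H.ker.inner_left_of_mem_orthogonal (H.ker.starProjection_apply_mem k) hx,
      sub_zero, ← real_inner_self_eq_norm_mul_norm, ← sub_eq_zero, ← inner_sub_left, ← neg_eq_zero,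
      ← inner_neg_left, neg_sub]
    exact H'.ker.starProjection_inner_eq_zero x k hk
  rcases (norm_nonneg k).eq_or_lt with hk0 | hk0
  · rw [← hk0, mul_zero]; positivity
  · refine le_of_mul_le_mul_right ?_ hk0
    calc c * ‖k‖ * ‖k‖ = c * ⟪x, r⟫_ℝ := by rw [mul_assoc, hxk]
      _ ≤ c * (‖x‖ * ‖r‖) := by gcongr; exact real_inner_le_norm x r
      _ = ‖x‖ * (c * ‖r‖) := by ring
      _ ≤ ‖x‖ * (‖H' - H‖ * ‖k‖) := by gcongr
      _ = ‖x‖ * ‖H' - H‖ * ‖k‖ := by ring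

end RankPersistence

variable [InnerProductSpace ℝ F] {H H' : E →L[ℝ] F} {x x' : E} {b b' : F} {c : ℝ}

/-- `x` is the minimizer of least norm of `‖H x + b‖`, expressed by the normal equations. -/
structure IsMinNormLeastSquares (H : E →L[ℝ] F) (b : F) (x : E) : Prop where
  mem_ker_orthogonal : x ∈ H.kerᗮ
  inner_residual : ∀ v, ⟪H x + b, H v⟫_ℝ = 0

namespace IsMinNormLeastSquares

theorem norm_apply_mul_self_le (h : IsMinNormLeastSquares H b x)
    (h' : IsMinNormLeastSquares H' b' x') {d : E} (hd : H' d = H' (x' - x)) :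
    ‖H' d‖ * ‖H' d‖
      ≤ (‖b' - b‖ + ‖H' - H‖ * ‖x‖) * ‖H' d‖ + ‖H x + b‖ * ‖H' - H‖ * ‖d‖ := by
  have hresidual : H' d = (H' x' + b') - (b' - b) - (H' - H) x - (H x + b) := by
    simp only [hd, map_sub, _root_.sub_apply]
    abel
  have hinner : ⟪H x + b, H' d⟫_ℝ = ⟪H x + b, (H' - H) d⟫_ℝ := by
    simp [inner_sub_right, h.inner_residual d]
  calc ‖H' d‖ * ‖H' d‖
      = ⟪-(b' - b), H' d⟫_ℝ + ⟪-(H' - H) x, H' d⟫_ℝ + ⟪-(H x + b), (H' - H) d⟫_ℝ := by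
        rw [← real_inner_self_eq_norm_mul_norm]
        refine (congrArg (⟪·, H' d⟫_ℝ) hresidual).trans ?_
        rw [inner_sub_left, inner_sub_left, inner_sub_left, h'.inner_residual, inner_neg_left,
          inner_neg_left, inner_neg_left, hinner]
        ring
    _ ≤ ‖b' - b‖ * ‖H' d‖ + ‖H' - H‖ * ‖x‖ * ‖H' d‖ + ‖H x + b‖ * (‖H' - H‖ * ‖d‖) := by
        gcongr <;> refine (real_inner_le_norm _ _).trans ?_ <;> rw [norm_neg]
        · gcongr; exact (H' - H).le_opNorm x
        · gcongr; exact (H' - H).le_opNorm d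
    _ = _ := by ring

variable [FiniteDimensional ℝ E]

theorem mul_norm_sub_le (h : IsMinNormLeastSquares H b x) (h' : IsMinNormLeastSquares H' b' x')
    (hc₀ : 0 < c) (hc : ∀ v ∈ H.kerᗮ, c * ‖v‖ ≤ ‖H v‖) (hc' : ∀ v ∈ H'.kerᗮ, c * ‖v‖ ≤ ‖H' v‖) :
    c ^ 2 * ‖x' - x‖ ≤ c * ‖b' - b‖ + (2 * c * ‖x‖ + ‖H x + b‖) * ‖H' - H‖ := by
  -- Split `x' - x = d - k` with `d` orthogonal to `ker H'` and `k` in it.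
  set k := H'.ker.starProjection x
  have hk : c * ‖k‖ ≤ ‖x‖ * ‖H' - H‖ := mul_norm_starProjection_ker_le hc₀.le hc h.1
  set d := x' - (x - k)
  have hd : c * ‖d‖ ≤ ‖H' d‖ :=
    hc' d (sub_mem h'.1 (H'.ker.sub_starProjection_mem_orthogonal x))
  have hHd : H' d = H' (x' - x) := by
    simp [d, show H' k = 0 from H'.ker.starProjection_apply_mem x]
  have hHd_le : c * ‖H' d‖ ≤ c * (‖b' - b‖ + ‖H' - H‖ * ‖x‖) + ‖H x + b‖ * ‖H' - H‖ := by
    rcases (norm_nonneg (H' d)).eq_or_lt with h0 | h0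
    · rw [← h0, mul_zero]; positivity
    · refine le_of_mul_le_mul_right ?_ h0
      have := mul_le_mul_of_nonneg_left hd (by positivity : 0 ≤ ‖H x + b‖ * ‖H' - H‖)
      linarith [mul_le_mul_of_nonneg_left (h.norm_apply_mul_self_le h' hHd) hc₀.le]
  calc c ^ 2 * ‖x' - x‖ = c ^ 2 * ‖d - k‖ := by rw [show d - k = x' - x by simp only [d]; abel]
    _ ≤ c ^ 2 * (‖d‖ + ‖k‖) := by gcongr; exact norm_sub_le d k
    _ = c * (c * ‖d‖) + c * (c * ‖k‖) := by ring
    _ ≤ c * ‖H' d‖ + c * (‖x‖ * ‖H' - H‖) := by gcongr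
    _ ≤ _ := by linarith

theorem deviatesBy {X : Type*} {l : Filter X} {g : X → ℝ} {H : X → E →L[ℝ] F} {b : X → F}
    {x : X → E} {H₀ : E →L[ℝ] F} {b₀ : F} {x₀ : E} (hg : Tendsto g l (𝓝 0))
    (hH : DeviatesBy l g H H₀) (hb : DeviatesBy l g b b₀)
    (hrank : ∀ᶠ y in l, finrank ℝ (H y).range = finrank ℝ H₀.range)
    (hx : ∀ᶠ y in l, IsMinNormLeastSquares (H y) (b y) (x y))
    (hx₀ : IsMinNormLeastSquares H₀ b₀ x₀) : DeviatesBy l g x x₀ := by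
  obtain ⟨c, hc₀, hc⟩ := exists_pos_mul_norm_le_of_mem_ker_orthogonal H₀
  have hc2 : ∀ v ∈ H₀.kerᗮ, c / 2 * ‖v‖ ≤ ‖H₀ v‖ := fun v hv =>
    (mul_le_mul_of_nonneg_right (by linarith) (norm_nonneg v)).trans (hc v hv)
  have hclose : ∀ᶠ y in l, ‖H y - H₀‖ < c / 2 := by
    simpa [dist_eq_norm] using (hH.tendsto hg).eventually (Metric.ball_mem_nhds H₀ (half_pos hc₀))
  have hbound : ∀ᶠ y in l, ‖(c / 2) ^ 2 • (x y - x₀)‖ ≤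
      ‖c / 2 * ‖b y - b₀‖ + (2 * (c / 2) * ‖x₀‖ + ‖H₀ x₀ + b₀‖) * ‖H y - H₀‖‖ := by
    filter_upwards [hrank, hx, hclose] with y hyrank hy hyclose
    have hc' := mul_norm_le_of_finrank_range_le hc hyclose.le (by linarith) hyrank.le
    rw [sub_half] at hc'
    rw [norm_smul, Real.norm_of_nonneg (sq_nonneg (c / 2))]
    exact (hx₀.mul_norm_sub_le hy (half_pos hc₀) hc2 hc').trans (le_abs_self _)
  have hright := (hb.norm_left.const_mul_left (c / 2)).add
    (hH.norm_left.const_mul_left (2 * (c / 2) * ‖x₀‖ + ‖H₀ x₀ + b₀‖))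
  exact (isBigO_const_smul_left (by positivity)).1
    ((IsBigO.of_norm_eventuallyLE hbound).trans hright.norm_left)

end IsMinNormLeastSquares

end LeastSquares

section FreeEntries

variable {nx nu : ℕ} {τ : ℝ} {M : Matrix ((Fin nx × Fin nu) ⊕ Fin nu) (ParamIdx nx nu) ℝ}
  {θ θ' : ParamIdx nx nu → ℝ} {𝒜 : Set (ConstrIdx nx nu)}

theorem selected_injective : Function.Injective (selected : ConstrIdx nx nu → ParamIdx nx nu) := by
  rintro (a | a | a) (b | b | b) h <;> simp_all [selected]

theorem selected_ne_offDiag {a b : Fin nu} (hab : a ≠ b) (j : ConstrIdx nx nu) :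
    selected j ≠ Sum.inr (Sum.inr (Sum.inl (b, a))) := by
  rcases j with j | j | j <;> simp [selected]
  grind

theorem selected_ne_last (j : ConstrIdx nx nu) : selected j ≠ Sum.inr (Sum.inr (Sum.inr ())) := by
  rcases j with j | j | j <;> simp [selected]

theorem selected_or_offDiag_or_last (p : ParamIdx nx nu) :
    (∃ j : ConstrIdx nx nu, selected j = p) ∨
      (∃ a b : Fin nu, a ≠ b ∧ p = Sum.inr (Sum.inr (Sum.inl (b, a)))) ∨
      p = Sum.inr (Sum.inr (Sum.inr ())) := by
  rcases p with q | l | ⟨b, a⟩ | ⟨⟩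
  · exact .inl ⟨.inl q, rfl⟩
  · exact .inl ⟨.inr (.inl l), rfl⟩
  · rcases eq_or_ne a b with rfl | hab
    · exact .inl ⟨.inr (.inr a), rfl⟩
    · exact .inr (.inl ⟨a, b, hab, rfl⟩)
  · exact .inr (.inr rfl)

theorem selectorD_mulVec (θ : ParamIdx nx nu → ℝ) (j : ConstrIdx nx nu) :
    (selectorD nx nu *ᵥ θ) j = θ (selected j) := by
  simp [selectorD, Matrix.mulVec, dotProduct]

theorem mem_activeSet {j : ConstrIdx nx nu} : j ∈ activeSet τ θ ↔ θ (selected j) = τ := by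
  rw [activeSet, Set.mem_ofPred_eq, selectorD_mulVec]

/-- The directions in which `θ` can be moved both ways when the constraints in `𝒜` are active: the
vectors supported on the free entries, those selected by `D` with an inactive constraint. -/
def freeDirections (𝒜 : Set (ConstrIdx nx nu)) :
    Submodule ℝ (EuclideanSpace ℝ (ParamIdx nx nu)) where
  carrier := {v | ∀ p ∉ selected '' 𝒜ᶜ, v p = 0}
  add_mem' hv hw p hp := by simp [hv p hp, hw p hp]
  zero_mem' _ _ := rfl
  smul_mem' c v hv p hp := by simp [hv p hp]

theorem IsFeasible.toLp_sub_mem_freeDirections (hθ : IsFeasible τ θ) (hθ' : IsFeasible τ θ')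
    (h : activeSet τ θ' = activeSet τ θ) :
    WithLp.toLp 2 θ' - WithLp.toLp 2 θ ∈ freeDirections (activeSet τ θ) := by
  intro p hp
  suffices θ' p = θ p by simp [this]
  obtain ⟨j, rfl⟩ | ⟨a, b, hab, rfl⟩ | rfl := selected_or_offDiag_or_last p
  · have hj : j ∈ activeSet τ θ := by_contra fun hj => hp ⟨j, hj, rfl⟩
    rw [mem_activeSet.1 hj, mem_activeSet.1 (h ▸ hj : j ∈ activeSet τ θ')]
  · exact (hθ'.2.1 a b hab).trans (hθ.2.1 a b hab).symm
  · rw [hθ.2.2, hθ'.2.2]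

theorem IsFeasible.eventually_add_smul (hθ : IsFeasible τ θ)
    {v : EuclideanSpace ℝ (ParamIdx nx nu)} (hv : v ∈ freeDirections (activeSet τ θ)) :
    ∀ᶠ s in 𝓝 (0 : ℝ), IsFeasible τ (θ + s • v.ofLp) ∧
      activeSet τ (θ + s • v.ofLp) = activeSet τ θ := by
  have hactive : ∀ j ∈ activeSet τ θ, v (selected j) = 0 := fun j hj =>
    hv _ fun ⟨_, hi, hij⟩ => hi (selected_injective hij ▸ hj)
  have hinactive : ∀ᶠ s in 𝓝 (0 : ℝ), ∀ j ∉ activeSet τ θ, τ < (θ + s • v.ofLp) (selected j) := by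
    refine eventually_all.2 fun j => eventually_imp_distrib_left.2 fun hj => ?_
    have hcont : Continuous fun s : ℝ => (θ + s • v.ofLp) (selected j) := by fun_prop
    refine (hcont.tendsto' 0 (θ (selected j)) (by simp)).eventually_const_lt ?_
    exact (selectorD_mulVec θ j ▸ hθ.1 j).lt_of_ne' fun h => hj (mem_activeSet.2 h)
  filter_upwards [hinactive] with s hs
  have hmem : ∀ j, j ∈ activeSet τ (θ + s • v.ofLp) ↔ j ∈ activeSet τ θ := fun j => by
    by_cases hj : j ∈ activeSet τ θ
    · simp [mem_activeSet, hactive j hj]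
    · simpa only [hj, iff_false, mem_activeSet] using (hs j hj).ne'
  refine ⟨⟨fun j => ?_, fun a b hab => ?_, ?_⟩, Set.ext hmem⟩
  · by_cases hj : j ∈ activeSet τ θ
    · exact ((hmem j).2 hj).ge
    · exact (selectorD_mulVec _ j).symm ▸ (hs j hj).le
  · have : v (Sum.inr (Sum.inr (Sum.inl (b, a)))) = 0 :=
      hv _ fun ⟨j, _, hj⟩ => selected_ne_offDiag hab j hj
    simpa [paramR, this] using hθ.2.1 a b hab
  · have : v (Sum.inr (Sum.inr (Sum.inr ()))) = 0 := hv _ fun ⟨j, _, hj⟩ => selected_ne_last j hj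
    simpa [this] using hθ.2.2

/-- The restriction of `M` to the free directions, as a linear function of `M`. -/
noncomputable def freeOp (𝒜 : Set (ConstrIdx nx nu)) :
    Matrix ((Fin nx × Fin nu) ⊕ Fin nu) (ParamIdx nx nu) ℝ →ₗ[ℝ]
      freeDirections 𝒜 →L[ℝ] EuclideanSpace ℝ ((Fin nx × Fin nu) ⊕ Fin nu) :=
  LinearMap.toContinuousLinearMap.toLinearMap ∘ₗ
    LinearMap.lcomp ℝ _ (freeDirections 𝒜).subtype ∘ₗ (Matrix.toLpLin 2 2).toLinearMap

theorem freeOp_apply (v : freeDirections 𝒜) :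
    freeOp 𝒜 M v = WithLp.toLp 2 (M *ᵥ (v : EuclideanSpace ℝ (ParamIdx nx nu)).ofLp) := rfl

theorem selectorD_transpose_mulVec_selected (u : ConstrIdx nx nu → ℝ) (j : ConstrIdx nx nu) :
    ((selectorD nx nu)ᵀ *ᵥ u) (selected j) = u j := by
  simp [selectorD, Matrix.mulVec, dotProduct, selected_injective.eq_iff]

theorem selectorD_transpose_mulVec_of_forall_ne (u : ConstrIdx nx nu → ℝ) {p : ParamIdx nx nu}
    (hp : ∀ j, selected j ≠ p) : ((selectorD nx nu)ᵀ *ᵥ u) p = 0 := by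
  simp [selectorD, Matrix.mulVec, dotProduct, hp]

open Classical in
theorem range_selectorD_transpose_mul_diagonal (𝒜 : Set (ConstrIdx nx nu)) :
    (Matrix.toLpLin 2 2 ((selectorD nx nu)ᵀ *
      Matrix.diagonal fun j => if j ∈ 𝒜 then (0 : ℝ) else 1)).range = freeDirections 𝒜 := by
  ext v
  constructor
  · rintro ⟨u, rfl⟩ p hp
    rw [Matrix.ofLp_toLpLin, Matrix.toLin'_apply, ← Matrix.mulVec_mulVec]
    by_cases hsel : ∃ j : ConstrIdx nx nu, selected j = p
    · obtain ⟨j, rfl⟩ := hsel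
      have hj : j ∈ 𝒜 := by_contra fun hj => hp ⟨j, hj, rfl⟩
      rw [selectorD_transpose_mulVec_selected, Matrix.mulVec_diagonal, if_pos hj, zero_mul]
    · exact selectorD_transpose_mulVec_of_forall_ne _ (not_exists.1 hsel)
  · refine fun hv => ⟨WithLp.toLp 2 fun j => v (selected j), PiLp.ext fun p => ?_⟩
    rw [Matrix.ofLp_toLpLin, Matrix.toLin'_apply, ← Matrix.mulVec_mulVec]
    by_cases hsel : ∃ j : ConstrIdx nx nu, selected j = p
    · obtain ⟨j, rfl⟩ := hsel
      rw [selectorD_transpose_mulVec_selected, Matrix.mulVec_diagonal]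
      split_ifs with hj
      · rw [zero_mul, hv _ fun ⟨_, hi, hij⟩ => hi (selected_injective hij ▸ hj)]
      · exact one_mul _
    · rw [selectorD_transpose_mulVec_of_forall_ne _ (not_exists.1 hsel),
        hv p fun ⟨j, _, hj⟩ => hsel ⟨j, hj⟩]

theorem finrank_range_freeOp :
    finrank ℝ (freeOp (activeSet τ θ) M).range = freeRank τ M θ := by
  classical
  rw [freeRank, Matrix.rank_eq_finrank_range_toLin _ (PiLp.basisFun 2 ℝ _) (PiLp.basisFun 2 ℝ _),
    ← Matrix.toLpLin_eq_toLin, Matrix.mul_assoc, Matrix.toLpLin_mul _ 2, LinearMap.range_comp,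
    range_selectorD_transpose_mul_diagonal, ← LinearMap.range_domRestrict]
  rfl

theorem IsLSSolution.inner_mulVec_eq_zero (h : IsLSSolution τ M θ)
    {v : EuclideanSpace ℝ (ParamIdx nx nu)} (hv : v ∈ freeDirections (activeSet τ θ)) :
    ⟪WithLp.toLp 2 (M *ᵥ θ), WithLp.toLp 2 (M *ᵥ v.ofLp)⟫_ℝ = 0 := by
  refine inner_eq_zero_of_eventually_norm_le ?_
  filter_upwards [h.1.eventually_add_smul hv] with s hs
  refine le_of_sq_le_sq ((h.2 _ hs.1).trans_eq ?_) (norm_nonneg _)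
  rw [Matrix.mulVec_add, Matrix.mulVec_smul, WithLp.toLp_add, WithLp.toLp_smul]

theorem IsReturnedSolution.inner_eq_zero_of_mulVec_eq_zero (h : IsReturnedSolution τ M θ)
    {v : EuclideanSpace ℝ (ParamIdx nx nu)} (hv : v ∈ freeDirections (activeSet τ θ))
    (hMv : M *ᵥ v.ofLp = 0) : ⟪WithLp.toLp 2 θ, v⟫_ℝ = 0 := by
  refine inner_eq_zero_of_eventually_norm_le ?_
  filter_upwards [h.1.1.eventually_add_smul hv] with s hs
  refine h.2 _ ⟨hs.1, fun θ' hθ' => ?_⟩ hs.2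
  have hsame : M *ᵥ (θ + s • v.ofLp) = M *ᵥ θ := by
    rw [Matrix.mulVec_add, Matrix.mulVec_smul, hMv, smul_zero, add_zero]
  exact hsame.symm ▸ h.1.2 θ' hθ'

theorem IsReturnedSolution.isMinNormLeastSquares (h : IsReturnedSolution τ M θ) :
    IsMinNormLeastSquares (freeOp (activeSet τ θ) M)
      (Matrix.toLpLin 2 2 M ((freeDirections (activeSet τ θ))ᗮ.starProjection (WithLp.toLp 2 θ)))
      ((freeDirections (activeSet τ θ)).orthogonalProjectionOnto (WithLp.toLp 2 θ)) where
  mem_ker_orthogonal v hv := by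
    rw [real_inner_comm, Submodule.coe_inner, Submodule.coe_orthogonalProjectionOnto_apply,
      Submodule.inner_starProjection_left_eq_right,
      Submodule.starProjection_eq_self_iff.2 v.2]
    exact h.inner_eq_zero_of_mulVec_eq_zero v.2 (congrArg WithLp.ofLp hv)
  inner_residual v := by
    have hsplit := Matrix.toLpLin 2 2 M |>.map_add
      ((freeDirections (activeSet τ θ)).starProjection (WithLp.toLp 2 θ))
      ((freeDirections (activeSet τ θ))ᗮ.starProjection (WithLp.toLp 2 θ))
    rw [Submodule.starProjection_add_starProjection_orthogonal] at hsplit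
    rw [freeOp_apply, ← h.1.inner_mulVec_eq_zero v.2]
    exact congrArg (⟪·, _⟫_ℝ) hsplit.symm

open scoped Matrix.Norms.Frobenius in
theorem IsReturnedSolution.deviatesBy {X : Type*} {l : Filter X} {g : X → ℝ}
    {M : X → Matrix ((Fin nx × Fin nu) ⊕ Fin nu) (ParamIdx nx nu) ℝ}
    {M₀ : Matrix ((Fin nx × Fin nu) ⊕ Fin nu) (ParamIdx nx nu) ℝ}
    {θ : X → ParamIdx nx nu → ℝ} {θ₀ : ParamIdx nx nu → ℝ} (hg : Tendsto g l (𝓝 0))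
    (hM : DeviatesBy l g M M₀) (hθ : ∀ᶠ x in l, IsReturnedSolution τ (M x) (θ x))
    (hθ₀ : IsReturnedSolution τ M₀ θ₀)
    (hactive : ∀ᶠ x in l, activeSet τ (θ x) = activeSet τ θ₀)
    (hrank : ∀ᶠ x in l, freeRank τ (M x) (θ x) = freeRank τ M₀ θ₀) :
    DeviatesBy l g (fun x => WithLp.toLp 2 (θ x)) (WithLp.toLp 2 θ₀) := by
  set V := freeDirections (activeSet τ θ₀)
  set fixed := Vᗮ.starProjection (WithLp.toLp 2 θ₀)
  have hsub : ∀ᶠ x in l, WithLp.toLp 2 (θ x) - WithLp.toLp 2 θ₀ ∈ V := by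
    filter_upwards [hθ, hactive] with x hx hxa
    exact hθ₀.1.1.toLp_sub_mem_freeDirections hx.1.1 hxa
  have hfree : DeviatesBy l g (fun x => V.orthogonalProjectionOnto (WithLp.toLp 2 (θ x)))
      (V.orthogonalProjectionOnto (WithLp.toLp 2 θ₀)) := by
    refine IsMinNormLeastSquares.deviatesBy hg (hM.map (freeOp (activeSet τ θ₀)))
      (hM.map ((Matrix.toLpLin 2 2).toLinearMap.flip fixed)) ?_ ?_ hθ₀.isMinNormLeastSquares
    · filter_upwards [hactive, hrank] with x hxa hxr
      rw [finrank_range_freeOp (M := M₀), ← hxr, ← finrank_range_freeOp, hxa]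
    · filter_upwards [hθ, hactive, hsub] with x hx hxa hxs
      have hfixed : Vᗮ.starProjection (WithLp.toLp 2 (θ x)) = fixed := by
        rw [← sub_eq_zero, ← map_sub, Submodule.starProjection_orthogonal_val,
          Submodule.starProjection_eq_self_iff.2 hxs, sub_self]
      have hls := hx.isMinNormLeastSquares
      rwa [hxa, hfixed] at hls
  refine (hfree.map V.subtype).congr' (hsub.mono fun x hx => ?_) .rfl
  beta_reduce
  rw [← map_sub, ← map_sub]
  exact Submodule.starProjection_eq_self_iff.2 hx

end FreeEntries

section Identification

open scoped Matrix.Norms.Frobenius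

variable {N nx nu T : ℕ} {τ : ℝ} {dyn : LinearDynamics N nx nu} {pol : AffinePolicy N nx nu}

/-- Along the filter `l`, the policies `pol'` deviate from `pol` by `O(g)` before the horizon `T`,
in the norm of `policyError`. -/
def PolicyDeviatesBy {X : Type*} (l : Filter X) (g : X → ℝ) (T : ℕ)
    (pol' : X → AffinePolicy N nx nu) (pol : AffinePolicy N nx nu) : Prop :=
  ∀ t < T, ∀ i, (fun x => policyError (pol' x) pol t i) =O[l] g

/-- The condition on the outcome `θ'` of the algorithm on `pol'` under which it is compared with the
outcome `θ` on `pol`, for the player `i` at the stage `r`: equal active sets, and submatrices of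
equal rank in the columns of the free entries. -/
def SameActiveRank (T : ℕ) (τ : ℝ) (dyn : LinearDynamics N nx nu) (pol' pol : AffinePolicy N nx nu)
    (θ' θ : ℕ → Fin N → ParamIdx nx nu → ℝ) (r : ℕ) (i : Fin N) : Prop :=
  activeSet τ (θ' r i) = activeSet τ (θ r i) ∧
    freeRank τ (matM T dyn pol' θ' r i) (θ' r i) = freeRank τ (matM T dyn pol θ r i) (θ r i)

variable {X : Type*} {l : Filter X} {g : X → ℝ} {pol' : X → AffinePolicy N nx nu} {t k : ℕ}
  {θ : ℕ → Fin N → ParamIdx nx nu → ℝ} {θ' : X → ℕ → Fin N → ParamIdx nx nu → ℝ} {i : Fin N}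

namespace PolicyDeviatesBy

theorem gain_offset (h : PolicyDeviatesBy l g T pol' pol) (ht : t < T) (i : Fin N) :
    DeviatesBy l g
      (fun x => Matrix.fromCols ((pol' x).K t i) (Matrix.replicateCol Unit ((pol' x).α t i)))
      (Matrix.fromCols (pol.K t i) (Matrix.replicateCol Unit (pol.α t i))) :=
  isBigO_norm_left.1 (h t ht i)

theorem gain (h : PolicyDeviatesBy l g T pol' pol) (ht : t < T) (i : Fin N) :
    DeviatesBy l g (fun x => (pol' x).K t i) (pol.K t i) :=
  DeviatesBy.matrix_iff.2 fun a b => DeviatesBy.matrix_iff.1 (h.gain_offset ht i) a (.inl b)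

theorem offset (h : PolicyDeviatesBy l g T pol' pol) (ht : t < T) (i : Fin N) :
    DeviatesBy l g (fun x => (pol' x).α t i) (pol.α t i) :=
  DeviatesBy.pi_iff.2 fun a => DeviatesBy.matrix_iff.1 (h.gain_offset ht i) a (.inr ())

variable (hg : Tendsto g l (𝓝 0)) (h : PolicyDeviatesBy l g T pol' pol)
include hg h

theorem closedLoop_deviatesBy (ht : t < T) :
    DeviatesBy l g (fun x => closedLoop dyn (pol' x) t) (closedLoop dyn pol t) :=
  .sub (.const _) (.sum fun j _ => .matrix_mul hg (.const _) (h.gain ht j))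

theorem drift_deviatesBy (ht : t < T) :
    DeviatesBy l g (fun x => drift dyn (pol' x) t) (drift dyn pol t) :=
  .sum fun j _ => .mulVec hg (.const _) (h.offset ht j)

theorem matS_deviatesBy (ht : t < T) (i : Fin N) :
    DeviatesBy l g (fun x => matS dyn (pol' x) t i) (matS dyn pol t i) :=
  .kronecker hg (closedLoop_deviatesBy hg h ht).transpose (.const _)

theorem vecE_deviatesBy (ht : t < T) (hF : IsUnit (closedLoop dyn pol t)) (i : Fin N) :
    DeviatesBy l g (fun x => vecE dyn (pol' x) t i) (vecE dyn pol t i) :=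
  .add (.mulVec hg (.matrix_mul hg (h.gain ht i) (.inv hg (closedLoop_deviatesBy hg h ht) hF))
    (drift_deviatesBy hg h ht)) (h.offset ht i)

theorem deltaBack_succ_deviatesBy (hk : k < T)
    (hΔ : DeviatesBy l g (fun x => deltaBack T dyn (pol' x) (θ' x) i k) (deltaBack T dyn pol θ i k))
    (hθ : DeviatesBy l g (fun x => θ' x (T - (k + 1) + 1) i) (θ (T - (k + 1) + 1) i)) :
    DeviatesBy l g (fun x => deltaBack T dyn (pol' x) (θ' x) i (k + 1))
      (deltaBack T dyn pol θ i (k + 1)) := by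
  have ht : T - (k + 1) < T := by omega
  have hQ : DeviatesBy l g (fun x => paramQ (θ' x (T - (k + 1) + 1) i)) (paramQ _) :=
    DeviatesBy.matrix_iff.2 fun _ _ => DeviatesBy.pi_iff.1 hθ _
  have hR : DeviatesBy l g (fun x => paramR (θ' x (T - (k + 1) + 1) i)) (paramR _) :=
    DeviatesBy.matrix_iff.2 fun _ _ => DeviatesBy.pi_iff.1 hθ _
  have hF := closedLoop_deviatesBy (dyn := dyn) hg h ht
  have hK := h.gain ht i
  exact .add (.matrix_mul hg (.matrix_mul hg hF.transpose (hΔ.add hQ)) hF)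
    (.matrix_mul hg (.matrix_mul hg hK.transpose hR) hK)

theorem omegaBack_succ_deviatesBy (hk : k < T)
    (hΔ : DeviatesBy l g (fun x => deltaBack T dyn (pol' x) (θ' x) i k) (deltaBack T dyn pol θ i k))
    (hΩ : DeviatesBy l g (fun x => omegaBack T dyn (pol' x) (θ' x) i k) (omegaBack T dyn pol θ i k))
    (hθ : DeviatesBy l g (fun x => θ' x (T - (k + 1) + 1) i) (θ (T - (k + 1) + 1) i)) :
    DeviatesBy l g (fun x => omegaBack T dyn (pol' x) (θ' x) i (k + 1))
      (omegaBack T dyn pol θ i (k + 1)) := by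
  have ht : T - (k + 1) < T := by omega
  have hQ : DeviatesBy l g (fun x => paramQ (θ' x (T - (k + 1) + 1) i)) (paramQ _) :=
    DeviatesBy.matrix_iff.2 fun _ _ => DeviatesBy.pi_iff.1 hθ _
  have hL : DeviatesBy l g (fun x => paramL (θ' x (T - (k + 1) + 1) i)) (paramL _) :=
    DeviatesBy.pi_iff.2 fun _ => DeviatesBy.pi_iff.1 hθ _
  have hR : DeviatesBy l g (fun x => paramR (θ' x (T - (k + 1) + 1) i)) (paramR _) :=
    DeviatesBy.matrix_iff.2 fun _ _ => DeviatesBy.pi_iff.1 hθ _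
  have hF := closedLoop_deviatesBy (dyn := dyn) hg h ht
  exact .add
    (.mulVec hg hF.transpose (.sub (hΩ.add hL)
      (.mulVec hg (hΔ.add hQ) (drift_deviatesBy hg h ht))))
    (.mulVec hg (.matrix_mul hg (h.gain ht i).transpose hR) (h.offset ht i))

theorem matM_deviatesBy (ht : t - 1 < T) (hF : IsUnit (closedLoop dyn pol (t - 1)))
    (hΔ : DeviatesBy l g (fun x => deltaBack T dyn (pol' x) (θ' x) i (T - t))
      (deltaBack T dyn pol θ i (T - t)))
    (hΩ : DeviatesBy l g (fun x => omegaBack T dyn (pol' x) (θ' x) i (T - t))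
      (omegaBack T dyn pol θ i (T - t))) :
    DeviatesBy l g (fun x => matM T dyn (pol' x) (θ' x) t i) (matM T dyn pol θ t i) := by
  have hS := matS_deviatesBy (dyn := dyn) hg h ht i
  have hE := DeviatesBy.pi_iff.1 (vecE_deviatesBy hg h ht hF i)
  refine .fromRows (.fromCols hS (.fromCols (.const _) (.fromCols
      (.neg (.kronecker hg (h.gain ht i).transpose (.const _)))
      (.replicateCol (.mulVec hg hS hΔ.vec)))))
    (.fromCols (.const _) (.fromCols (.const _) (.fromCols (.neg ?_)
      (.replicateCol (.mulVec hg (.const _) hΩ)))))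
  exact DeviatesBy.matrix_iff.2 fun _ b => .mul hg (hE b.1) (.const _)

end PolicyDeviatesBy

theorem IsIdentified.deviatesBy_of_deltaBack_of_omegaBack (hg : Tendsto g l (𝓝 0))
    (hF : ∀ t < T, IsUnit (closedLoop dyn pol t)) (h : PolicyDeviatesBy l g T pol' pol)
    (hθ : IsIdentified T τ dyn pol θ) (hθ' : ∀ᶠ x in l, IsIdentified T τ dyn (pol' x) (θ' x))
    (ht : 1 ≤ t) (htT : t ≤ T)
    (hsame : ∀ᶠ x in l, SameActiveRank T τ dyn (pol' x) pol (θ' x) θ t i)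
    (hΔ : DeviatesBy l g (fun x => deltaBack T dyn (pol' x) (θ' x) i (T - t))
      (deltaBack T dyn pol θ i (T - t)))
    (hΩ : DeviatesBy l g (fun x => omegaBack T dyn (pol' x) (θ' x) i (T - t))
      (omegaBack T dyn pol θ i (T - t))) :
    DeviatesBy l g (fun x => WithLp.toLp 2 (θ' x t i)) (WithLp.toLp 2 (θ t i)) :=
  IsReturnedSolution.deviatesBy hg
    (PolicyDeviatesBy.matM_deviatesBy hg h (by omega) (hF _ (by omega)) hΔ hΩ)
    (hθ'.mono fun _ hx => hx t ht htT i) (hθ t ht htT i)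
    (hsame.mono fun _ hx => hx.1) (hsame.mono fun _ hx => hx.2)

theorem IsIdentified.deltaBack_omegaBack_deviatesBy (hg : Tendsto g l (𝓝 0))
    (hF : ∀ t < T, IsUnit (closedLoop dyn pol t)) (h : PolicyDeviatesBy l g T pol' pol)
    (hθ : IsIdentified T τ dyn pol θ) (hθ' : ∀ᶠ x in l, IsIdentified T τ dyn (pol' x) (θ' x))
    (hk : k < T) (hsame : ∀ r, T - k < r → r ≤ T →
      ∀ᶠ x in l, SameActiveRank T τ dyn (pol' x) pol (θ' x) θ r i) :
    DeviatesBy l g (fun x => deltaBack T dyn (pol' x) (θ' x) i k) (deltaBack T dyn pol θ i k) ∧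
    DeviatesBy l g (fun x => omegaBack T dyn (pol' x) (θ' x) i k)
      (omegaBack T dyn pol θ i k) := by
  induction k with
  | zero => exact ⟨.const _, .const _⟩
  | succ k ih =>
    obtain ⟨hΔ, hΩ⟩ := ih (by omega) fun r hr hrT => hsame r (by omega) hrT
    have hstage : T - (T - (k + 1) + 1) = k := by omega
    have hparam := (deviatesBy_of_deltaBack_of_omegaBack (t := T - (k + 1) + 1) hg hF h hθ hθ'
      (by omega) (by omega) (hsame _ (by omega) (by omega)) (by rwa [hstage])
      (by rwa [hstage])).map (WithLp.linearEquiv 2 ℝ (ParamIdx nx nu → ℝ)).toLinearMap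
    exact ⟨h.deltaBack_succ_deviatesBy hg (by omega) hΔ hparam,
      h.omegaBack_succ_deviatesBy hg (by omega) hΔ hΩ hparam⟩

theorem IsIdentified.deviatesBy (hg : Tendsto g l (𝓝 0))
    (hF : ∀ t < T, IsUnit (closedLoop dyn pol t)) (h : PolicyDeviatesBy l g T pol' pol)
    (hθ : IsIdentified T τ dyn pol θ) (hθ' : ∀ᶠ x in l, IsIdentified T τ dyn (pol' x) (θ' x))
    (ht : 1 ≤ t) (htT : t ≤ T) (hsame : ∀ r, t ≤ r → r ≤ T →
      ∀ᶠ x in l, SameActiveRank T τ dyn (pol' x) pol (θ' x) θ r i) :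
    DeviatesBy l g (fun x => WithLp.toLp 2 (θ' x t i)) (WithLp.toLp 2 (θ t i)) := by
  obtain ⟨hΔ, hΩ⟩ := deltaBack_omegaBack_deviatesBy (k := T - t) hg hF h hθ hθ' (by omega)
    fun r hr hrT => hsame r (by omega) hrT
  exact deviatesBy_of_deltaBack_of_omegaBack hg hF h hθ hθ' ht htT (hsame t le_rfl htT) hΔ hΩ

theorem IsIdentified.eventually_norm_sub_le (hF : ∀ t < T, IsUnit (closedLoop dyn pol t))
    (hθ : IsIdentified T τ dyn pol θ) (ht : 1 ≤ t) (htT : t ≤ T) (i : Fin N) :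
    ∀ᶠ C : ℝ in atTop, ∀ᶠ ε in 𝓝[>] (0 : ℝ), ∀ (pol' : AffinePolicy N nx nu)
      (θ' : ℕ → Fin N → ParamIdx nx nu → ℝ), (∀ r < T, ∀ j, policyError pol' pol r j ≤ ε) →
      IsIdentified T τ dyn pol' θ' →
      (∀ r, t ≤ r → r ≤ T → SameActiveRank T τ dyn pol' pol θ' θ r i) →
      ‖WithLp.toLp 2 (θ' t i - θ t i)‖ ≤ C * ε := by
  let S : Set (ℝ × AffinePolicy N nx nu × (ℕ → Fin N → ParamIdx nx nu → ℝ)) :=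
    {y | (∀ r < T, ∀ j, policyError y.2.1 pol r j ≤ y.1) ∧ IsIdentified T τ dyn y.2.1 y.2.2 ∧
      ∀ r, t ≤ r → r ≤ T → SameActiveRank T τ dyn y.2.1 pol y.2.2 θ r i}
  let l := comap Prod.fst (𝓝[>] 0) ⊓ 𝓟 S
  have hS : ∀ᶠ y in l, y ∈ S := mem_inf_of_right (mem_principal_self S)
  have hg : Tendsto Prod.fst l (𝓝 0) := (tendsto_comap.mono_left inf_le_left).mono_right inf_le_left
  have hpol : PolicyDeviatesBy l Prod.fst T (fun y => y.2.1) pol := fun r hr j =>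
    .of_bound 1 <| hS.mono fun y hy => by
      rw [one_mul]
      exact (norm_norm _).trans_le ((hy.1 r hr j).trans (le_abs_self _))
  have hdev := hθ.deviatesBy hg hF hpol (hS.mono fun y hy => hy.2.1) ht htT
    fun r hr hrT => hS.mono fun y hy => hy.2.2 r hr hrT
  filter_upwards [isBigO_iff_eventually.1 hdev] with C hC
  filter_upwards [eventually_comap.1 (eventually_inf_principal.1 hC), self_mem_nhdsWithin]
    with ε hε hpos pol' θ' hpol' hθ' hsame
  simpa only [Real.norm_of_nonneg hpos.le, ← WithLp.toLp_sub] using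
    hε (ε, pol', θ') rfl ⟨hpol', hθ', hsame⟩

theorem IsIdentified.exists_norm_sub_le (hF : ∀ t < T, IsUnit (closedLoop dyn pol t))
    (hθ : IsIdentified T τ dyn pol θ) :
    ∃ C > 0, ∃ ε₀ > 0, ∀ ε, 0 < ε → ε ≤ ε₀ → ∀ (pol' : AffinePolicy N nx nu)
      (θ' : ℕ → Fin N → ParamIdx nx nu → ℝ), (∀ t < T, ∀ i, policyError pol' pol t i ≤ ε) →
      IsIdentified T τ dyn pol' θ' → ∀ t, 1 ≤ t → t ≤ T → ∀ i,
      (∀ r, t ≤ r → r ≤ T → SameActiveRank T τ dyn pol' pol θ' θ r i) →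
      ‖WithLp.toLp 2 (θ' t i - θ t i)‖ ≤ C * ε := by
  have hall := (Finset.eventually_all (Finset.Icc 1 T)).2 fun t ht => eventually_all.2 fun i =>
    hθ.eventually_norm_sub_le hF (Finset.mem_Icc.1 ht).1 (Finset.mem_Icc.1 ht).2 i
  obtain ⟨C, hC, hC₀⟩ := (hall.and (eventually_gt_atTop 0)).exists
  obtain ⟨ε₀, hε₀, hsub⟩ := mem_nhdsGT_iff_exists_Ioc_subset.1 <|
    (Finset.eventually_all (Finset.Icc 1 T)).2 fun t ht => eventually_all.2 (hC t ht)
  exact ⟨C, hC₀, ε₀, hε₀, fun ε hε hle pol' θ' hpol' hθ' t ht htT i hsame =>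
    hsub ⟨hε, hle⟩ t (Finset.mem_Icc.2 ⟨ht, htT⟩) i pol' θ' hpol' hθ' hsame⟩

end Identification

section Concentration

variable {Ω : Type*} [MeasurableSpace Ω] {P : Measure Ω}

theorem measureReal_le_card_mul_of_subset_iUnion [IsFiniteMeasure P] {J : Type*} [Fintype J]
    {S : Set Ω} {bad : J → Set Ω} {b : ℝ} (hS : S ⊆ ⋃ j, bad j) (hbad : ∀ j, P.real (bad j) ≤ b) :
    P.real S ≤ Fintype.card J * b :=
  calc P.real S ≤ P.real (⋃ j, bad j) := measureReal_mono hS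
    _ ≤ ∑ j, P.real (bad j) := measureReal_iUnion_fintype_le _
    _ ≤ ∑ _j : J, b := Finset.sum_le_sum fun j _ => hbad j
    _ = Fintype.card J * b := by simp

theorem measureReal_le_abs_le_of_hasSubgaussianMGF [IsFiniteMeasure P] {X : Ω → ℝ} {c : ℝ≥0}
    {b ε : ℝ} (hX : HasSubgaussianMGF X c P) (hcb : c ≤ b) (hb : 0 < b) (hε : 0 ≤ ε) :
    P.real {ω | ε ≤ |X ω|} ≤ 2 * Real.exp (-ε ^ 2 / (2 * b)) := by
  have hX' : HasSubgaussianMGF X ⟨b, hb.le⟩ P :=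
    ⟨hX.integrable_exp_mul, fun t => (hX.mgf_le t).trans <| by gcongr; exact hcb⟩
  have hsub : {ω | ε ≤ |X ω|} ⊆ {ω | ε ≤ X ω} ∪ {ω | ε ≤ (-X) ω} :=
    fun ω (hω : ε ≤ |X ω|) => (le_abs.1 hω : ε ≤ X ω ∨ ε ≤ -X ω)
  calc P.real {ω | ε ≤ |X ω|} ≤ P.real {ω | ε ≤ X ω} + P.real {ω | ε ≤ (-X) ω} :=
        (measureReal_mono hsub).trans (measureReal_union_le _ _)
    _ ≤ Real.exp (-ε ^ 2 / (2 * b)) + Real.exp (-ε ^ 2 / (2 * b)) :=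
        add_le_add (hX'.measure_ge_le hε) (hX'.neg.measure_ge_le hε)
    _ = 2 * Real.exp (-ε ^ 2 / (2 * b)) := (two_mul _).symm

theorem measureReal_le_abs_sum_sub_le_of_abs_le_one [IsProbabilityMeasure P] {n : ℕ}
    {X : Fin n → Ω → ℝ} {m κ : ℝ} (hind : iIndepFun X P) (hmeas : ∀ s, AEMeasurable (X s) P)
    (hbound : ∀ s ω, |X s ω| ≤ 1) (hmean : ∀ s, P[X s] = m) (hn : 0 < n) (hκ : 0 ≤ κ) :
    P.real {ω | n * κ ≤ |∑ s, X s ω - n * m|} ≤ 2 * Real.exp (-(n * (κ ^ 2 / 2))) := by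
  have hsub (s : Fin n) : HasSubgaussianMGF (fun ω => X s ω - m) 1 P := by
    have h := hasSubgaussianMGF_of_mem_Icc (a := -1) (b := 1) (hmeas s)
      (.of_forall fun ω => abs_le.1 (hbound s ω))
    rw [hmean s] at h
    convert! h
    apply NNReal.eq
    norm_num
  have hsum := HasSubgaussianMGF.sum_of_iIndepFun (s := Finset.univ)
    (hind.comp (fun _ y => y - m) fun _ => by fun_prop) fun s _ => hsub s
  have htail := measureReal_le_abs_le_of_hasSubgaussianMGF (b := n) (ε := n * κ) hsum (by simp)
    (by exact_mod_cast hn) (by positivity)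
  have hexp : -(n * κ) ^ 2 / (2 * n : ℝ) = -(n * (κ ^ 2 / 2)) := by field_simp
  simpa only [Finset.sum_sub_distrib, Finset.sum_const, Finset.card_univ, Fintype.card_fin,
    nsmul_eq_mul, hexp, Function.comp_apply] using htail

theorem indepFun_pi_of_iIndepFun_prodMk [IsProbabilityMeasure P] {ι α β : Type*} [Finite ι]
    [MeasurableSpace α] [MeasurableSpace β] {X : ι → Ω → α} {Y : ι → Ω → β}
    (hind : iIndepFun (fun s ω => (X s ω, Y s ω)) P) (hXY : ∀ s, IndepFun (X s) (Y s) P)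
    (hX : ∀ s, AEMeasurable (X s) P) (hY : ∀ s, AEMeasurable (Y s) P) :
    IndepFun (fun ω s => X s ω) (fun ω s => Y s ω) P := by
  have := Fintype.ofFinite ι
  have hXm := aemeasurable_pi_lambda (fun ω s => X s ω) hX
  have hYm := aemeasurable_pi_lambda (fun ω s => Y s ω) hY
  have (s : ι) : IsProbabilityMeasure (P.map (X s)) := Measure.isProbabilityMeasure_map (hX s)
  have (s : ι) : IsProbabilityMeasure (P.map (Y s)) := Measure.isProbabilityMeasure_map (hY s)
  have hpair : P.map (fun ω s => (X s ω, Y s ω))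
      = Measure.pi fun s => (P.map (X s)).prod (P.map (Y s)) := by
    rw [hind.map_fun_eq_pi_map fun s => (hX s).prodMk (hY s)]
    exact congrArg _ (funext fun s => (hXY s).map_prod_eq_prod_map_map (hX s) (hY s))
  have hXind : P.map (fun ω s => X s ω) = Measure.pi fun s => P.map (X s) :=
    (hind.comp (fun _ => Prod.fst) fun _ => measurable_fst).map_fun_eq_pi_map hX
  have hYind : P.map (fun ω s => Y s ω) = Measure.pi fun s => P.map (Y s) :=
    (hind.comp (fun _ => Prod.snd) fun _ => measurable_snd).map_fun_eq_pi_map hY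
  rw [indepFun_iff_map_prod_eq_prod_map_map hXm hYm, hXind, hYind,
    ← (measurePreserving_arrowProdEquivProdArrow α β ι _ _).map_eq, ← hpair,
    AEMeasurable.map_map_of_aemeasurable (MeasurableEquiv.measurable _).aemeasurable
      (aemeasurable_pi_lambda _ fun s => (hX s).prodMk (hY s))]
  rfl

theorem measureReal_mem_le_of_indepFun [IsProbabilityMeasure P] {α β : Type*} [MeasurableSpace α]
    [MeasurableSpace β] {A : Ω → α} {V : Ω → β} (hind : IndepFun A V P) (hA : AEMeasurable A P)
    (hV : AEMeasurable V P) {S : Set (α × β)} (hS : MeasurableSet S) {b : ℝ} (hb : 0 ≤ b)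
    (hsection : ∀ a, P.real {ω | (a, V ω) ∈ S} ≤ b) : P.real {ω | (A ω, V ω) ∈ S} ≤ b := by
  have := Measure.isProbabilityMeasure_map (μ := P) hA
  have := Measure.isProbabilityMeasure_map (μ := P) hV
  refine ENNReal.toReal_le_of_le_ofReal hb ?_
  calc P {ω | (A ω, V ω) ∈ S} = P.map (fun ω => (A ω, V ω)) S :=
        (Measure.map_apply_of_aemeasurable (hA.prodMk hV) hS).symm
    _ = ∫⁻ a, P.map V (Prod.mk a ⁻¹' S) ∂P.map A := by
        rw [hind.map_prod_eq_prod_map_map hA hV, Measure.prod_apply hS]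
    _ ≤ ∫⁻ _, ENNReal.ofReal b ∂P.map A := lintegral_mono fun a => by
        rw [Measure.map_apply_of_aemeasurable hV (measurable_prodMk_left hS)]
        exact (ENNReal.le_ofReal_iff_toReal_le (measure_ne_top _ _) hb).2 (hsection a)
    _ = ENNReal.ofReal b := by simp

theorem measureReal_le_abs_sum_mul_le_of_hasSubgaussianMGF [IsProbabilityMeasure P] {ι : Type*}
    [Fintype ι] {A V : ι → Ω → ℝ} {c : ℝ≥0} {b ε : ℝ} (hA : ∀ s, AEMeasurable (A s) P)
    (hAV : IndepFun (fun ω s => A s ω) (fun ω s => V s ω) P) (hV : iIndepFun V P)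
    (hsub : ∀ s, HasSubgaussianMGF (V s) c P) (hb : 0 < b) (hε : 0 ≤ ε) :
    P.real {ω | (∑ s, A s ω ^ 2) * c ≤ b ∧ ε ≤ |∑ s, A s ω * V s ω|}
      ≤ 2 * Real.exp (-ε ^ 2 / (2 * b)) := by
  let S : Set ((ι → ℝ) × (ι → ℝ)) :=
    {y | (∑ s, y.1 s ^ 2) * c ≤ b ∧ ε ≤ |∑ s, y.1 s * y.2 s|}
  have hsq : Measurable fun y : (ι → ℝ) × (ι → ℝ) => (∑ s, y.1 s ^ 2) * (c : ℝ) := by fun_prop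
  have hcross : Measurable fun y : (ι → ℝ) × (ι → ℝ) => |∑ s, y.1 s * y.2 s| := by fun_prop
  have hS : MeasurableSet S :=
    (measurableSet_le hsq measurable_const).inter (measurableSet_le measurable_const hcross)
  refine measureReal_mem_le_of_indepFun hAV (aemeasurable_pi_lambda _ hA)
    (aemeasurable_pi_lambda _ fun s => (hsub s).aemeasurable) hS (by positivity) fun a => ?_
  by_cases ha : (∑ s, a s ^ 2) * c ≤ b
  · have hsum := HasSubgaussianMGF.sum_of_iIndepFun (s := Finset.univ)
      (hV.comp (fun s y => a s * y) fun _ => by fun_prop) fun s _ => (hsub s).const_mul (a s)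
    have htail := measureReal_le_abs_le_of_hasSubgaussianMGF (ε := ε) hsum
      (by rw [NNReal.coe_sum]; exact (Finset.sum_mul ..).symm.trans_le ha) hb hε
    exact (measureReal_mono fun ω hω => hω.2).trans htail
  · have hempty : {ω | (a, fun s => V s ω) ∈ S} = ∅ :=
      Set.eq_empty_of_forall_notMem fun ω hω => ha hω.1
    rw [hempty, measureReal_empty]
    positivity

end Concentration

section Gram

variable {Y S ι : Type*} [MeasurableSpace Y] [Fintype S] [Fintype ι]

theorem dotProduct_self_nonneg (v : ι → ℝ) : 0 ≤ v ⬝ᵥ v := by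
  simpa using dotProduct_star_self_nonneg v

/-- The matrix `z zᵀ / ‖z‖²`. Its entries are bounded whatever the regressor `z` is, so that sums of
independent copies concentrate. -/
noncomputable def normalizedGram (z : ι → ℝ) : Matrix ι ι ℝ := (z ⬝ᵥ z)⁻¹ • vecMulVec z z

theorem dotProduct_normalizedGram_mulVec (z v : ι → ℝ) :
    v ⬝ᵥ normalizedGram z *ᵥ v = (z ⬝ᵥ v) ^ 2 / (z ⬝ᵥ z) := by
  rw [normalizedGram, smul_mulVec, vecMulVec_mulVec, dotProduct_smul, op_smul_eq_smul,
    dotProduct_smul, dotProduct_comm v z]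
  simp only [smul_eq_mul]
  ring

theorem abs_normalizedGram_le_one (z : ι → ℝ) (p q : ι) : |normalizedGram z p q| ≤ 1 := by
  have hentry (k : ι) : |z k| ≤ √(z ⬝ᵥ z) := Real.abs_le_sqrt <| (sq (z k)).trans_le <|
    Finset.single_le_sum (f := fun k => z k * z k) (fun _ _ => mul_self_nonneg _)
      (Finset.mem_univ k)
  have hz : 0 ≤ z ⬝ᵥ z := dotProduct_self_nonneg z
  calc |normalizedGram z p q| = |z p| * |z q| / (z ⬝ᵥ z) := by
        rw [normalizedGram, Matrix.smul_apply, vecMulVec_apply, smul_eq_mul, abs_mul, abs_mul,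
          abs_inv, abs_of_nonneg hz, inv_mul_eq_div]
    _ ≤ √(z ⬝ᵥ z) * √(z ⬝ᵥ z) / (z ⬝ᵥ z) := by gcongr <;> exact hentry _
    _ ≤ 1 := by rw [Real.mul_self_sqrt hz]; exact div_self_le_one _

theorem measurable_normalizedGram_apply (p q : ι) :
    Measurable fun z : ι → ℝ => normalizedGram z p q := by
  simp only [normalizedGram, dotProduct, Matrix.smul_apply, vecMulVec_apply, smul_eq_mul]
  fun_prop

theorem exists_pos_mul_dotProduct_self_le {M : Matrix ι ι ℝ}
    (hM : ∀ v, v ≠ 0 → 0 < v ⬝ᵥ M *ᵥ v) : ∃ c > 0, ∀ v, c * (v ⬝ᵥ v) ≤ v ⬝ᵥ M *ᵥ v := by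
  rcases isEmpty_or_nonempty ι with hι | hι
  · exact ⟨1, one_pos, fun v => by simp [dotProduct]⟩
  let f : EuclideanSpace ℝ ι → ℝ := fun v => v.ofLp ⬝ᵥ M *ᵥ v.ofLp
  have hf : Continuous f := by fun_prop
  obtain ⟨e, he, hmin⟩ := (isCompact_sphere (0 : EuclideanSpace ℝ ι) 1).exists_isMinOn
    (NormedSpace.sphere_nonempty.2 zero_le_one) hf.continuousOn
  have he₀ : e.ofLp ≠ 0 := fun h => ne_zero_of_mem_unit_sphere ⟨e, he⟩ <| by ext i; simp [h]
  refine ⟨f e, hM _ he₀, fun v => ?_⟩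
  rcases eq_or_ne v 0 with rfl | hv
  · simp
  set x : EuclideanSpace ℝ ι := WithLp.toLp 2 v with hx
  have hx₀ : 0 < ‖x‖ := norm_pos_iff.2 <| by simpa [hx] using hv
  have hnorm : v ⬝ᵥ v = ‖x‖ ^ 2 := by
    rw [EuclideanSpace.real_norm_sq_eq]
    simp only [dotProduct, sq, hx]
  have hscale : f (‖x‖⁻¹ • x) = f x / ‖x‖ ^ 2 := by
    simp only [f, WithLp.ofLp_smul, mulVec_smul, dotProduct_smul, smul_dotProduct, smul_eq_mul]
    field_simp
  rw [hnorm, ← le_div_iff₀ (by positivity)]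
  exact (hmin (by simp [norm_smul, hx₀.ne'])).trans_eq hscale

/-- The mean of `normalizedGram z` for a random regressor `z`. -/
noncomputable def meanNormalizedGram (ρ : Measure Y) (z : Y → ι → ℝ) : Matrix ι ι ℝ :=
  Matrix.of fun p q => ∫ y, normalizedGram (z y) p q ∂ρ

theorem dotProduct_meanNormalizedGram_mulVec {ρ : Measure Y} [IsFiniteMeasure ρ] {z : Y → ι → ℝ}
    (hz : Measurable z) (v : ι → ℝ) :
    Integrable (fun y => (z y ⬝ᵥ v) ^ 2 / (z y ⬝ᵥ z y)) ρ ∧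
      v ⬝ᵥ meanNormalizedGram ρ z *ᵥ v = ∫ y, (z y ⬝ᵥ v) ^ 2 / (z y ⬝ᵥ z y) ∂ρ := by
  have hint (p q : ι) : Integrable (fun y => normalizedGram (z y) p q) ρ :=
    .of_bound ((measurable_normalizedGram_apply p q).comp hz).aestronglyMeasurable 1
      (.of_forall fun y => abs_normalizedGram_le_one _ _ _)
  have hterm (p q : ι) : Integrable (fun y => v p * (normalizedGram (z y) p q * v q)) ρ :=
    ((hint p q).mul_const _).const_mul _
  simp only [← dotProduct_normalizedGram_mulVec]
  simp only [dotProduct, mulVec, Finset.mul_sum, meanNormalizedGram, Matrix.of_apply]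
  refine ⟨integrable_finsetSum _ fun p _ => integrable_finsetSum _ fun q _ => hterm p q, ?_⟩
  rw [integral_finsetSum _ fun p _ => integrable_finsetSum _ fun q _ => hterm p q]
  refine Finset.sum_congr rfl fun p _ => ?_
  rw [integral_finsetSum _ fun q _ => hterm p q]
  simp only [integral_const_mul, integral_mul_const]

theorem exists_pos_mul_dotProduct_self_le_meanNormalizedGram {ρ : Measure Y} [IsFiniteMeasure ρ]
    {z : Y → ι → ℝ} (hz : Measurable z) (hz₀ : ∀ v, (∀ᵐ y ∂ρ, z y ⬝ᵥ v = 0) → v = 0) :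
    ∃ c > 0, ∀ v, c * (v ⬝ᵥ v) ≤ v ⬝ᵥ meanNormalizedGram ρ z *ᵥ v := by
  refine exists_pos_mul_dotProduct_self_le fun v hv => ?_
  obtain ⟨hint, hmean⟩ := dotProduct_meanNormalizedGram_mulVec (ρ := ρ) hz v
  have hnonneg : 0 ≤ fun y => (z y ⬝ᵥ v) ^ 2 / (z y ⬝ᵥ z y) := fun y =>
    div_nonneg (sq_nonneg _) (dotProduct_self_nonneg _)
  rw [hmean]
  refine (integral_nonneg hnonneg).lt_of_ne fun h => hv (hz₀ v ?_)
  filter_upwards [(integral_eq_zero_iff_of_nonneg hnonneg hint).1 h.symm] with y hy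
  rcases div_eq_zero_iff.1 hy with h | h
  · exact pow_eq_zero_iff two_ne_zero |>.1 h
  · rw [dotProduct_self_eq_zero.1 h, zero_dotProduct]

theorem abs_dotProduct_mulVec_le {M : Matrix ι ι ℝ} {κ : ℝ} (hM : ∀ p q, |M p q| ≤ κ) (hκ : 0 ≤ κ)
    (v : ι → ℝ) : |v ⬝ᵥ M *ᵥ v| ≤ κ * Fintype.card ι * (v ⬝ᵥ v) := by
  have hcs : (∑ p, |v p|) ^ 2 ≤ Fintype.card ι * (v ⬝ᵥ v) := by
    simpa [dotProduct, sq] using sq_sum_le_card_mul_sum_sq (s := Finset.univ) (f := fun p => |v p|)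
  calc |v ⬝ᵥ M *ᵥ v| = |∑ p, ∑ q, v p * (M p q * v q)| := by
        simp only [dotProduct, mulVec, Finset.mul_sum]
    _ ≤ ∑ p, ∑ q, |v p| * (κ * |v q|) := by
        refine (Finset.abs_sum_le_sum_abs _ _).trans (Finset.sum_le_sum fun p _ => ?_)
        refine (Finset.abs_sum_le_sum_abs _ _).trans (Finset.sum_le_sum fun q _ => ?_)
        rw [abs_mul, abs_mul]
        gcongr
        exact hM p q
    _ = κ * (∑ p, |v p|) ^ 2 := by
        rw [sq, Finset.sum_mul_sum, Finset.mul_sum]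
        refine Finset.sum_congr rfl fun p _ => ?_
        rw [Finset.mul_sum]
        exact Finset.sum_congr rfl fun q _ => by ring
    _ ≤ κ * (Fintype.card ι * (v ⬝ᵥ v)) := by gcongr
    _ = κ * Fintype.card ι * (v ⬝ᵥ v) := by ring

theorem mul_dotProduct_self_le_of_normalizedGram_close {Z : Matrix S ι ℝ} {M : Matrix ι ι ℝ}
    {c κ : ℝ} (hZ : ∀ s, 1 ≤ Z s ⬝ᵥ Z s) (hM : ∀ v, c * (v ⬝ᵥ v) ≤ v ⬝ᵥ M *ᵥ v) (hκ : 0 ≤ κ)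
    (hclose : ∀ p q, |∑ s, normalizedGram (Z s) p q - Fintype.card S * M p q|
      ≤ Fintype.card S * κ) (v : ι → ℝ) :
    Fintype.card S * (c - κ * Fintype.card ι) * (v ⬝ᵥ v) ≤ (Z *ᵥ v) ⬝ᵥ (Z *ᵥ v) := by
  set n : ℝ := (Fintype.card S : ℝ)
  have hn₀ : 0 ≤ n := Nat.cast_nonneg _
  have hdev : |v ⬝ᵥ (∑ s, normalizedGram (Z s) - n • M) *ᵥ v|
      ≤ n * κ * Fintype.card ι * (v ⬝ᵥ v) :=
    abs_dotProduct_mulVec_le (by simpa [Matrix.sum_apply] using hclose) (by positivity) v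
  have hnormalized : v ⬝ᵥ (∑ s, normalizedGram (Z s)) *ᵥ v ≤ (Z *ᵥ v) ⬝ᵥ (Z *ᵥ v) := by
    rw [sum_mulVec, dotProduct_sum]
    refine Finset.sum_le_sum fun s _ => ?_
    rw [dotProduct_normalizedGram_mulVec]
    exact (div_le_self (sq_nonneg _) (hZ s)).trans_eq (sq _)
  rw [sub_mulVec, dotProduct_sub, smul_mulVec, dotProduct_smul, smul_eq_mul] at hdev
  nlinarith [(abs_le.1 hdev).1, mul_le_mul_of_nonneg_left (hM v) hn₀]

end Gram

section LeastSquaresMatrix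

variable {S ι : Type*} [Fintype S] [Fintype ι] {Z : Matrix S ι ℝ} {c : ℝ}

theorem transpose_mulVec_residual_eq_zero {κ : Type*} [Fintype κ] {u : S → κ → ℝ}
    {W : Matrix κ ι ℝ}
    (hW : ∀ W' : Matrix κ ι ℝ, ∑ s, ‖WithLp.toLp 2 (W *ᵥ Z s + u s)‖ ^ 2
      ≤ ∑ s, ‖WithLp.toLp 2 (W' *ᵥ Z s + u s)‖ ^ 2) (a : κ) :
    Zᵀ *ᵥ (Z *ᵥ W a + fun s => u s a) = 0 := by
  classical
  let residual (W : Matrix κ ι ℝ) : PiLp 2 fun _ : S => EuclideanSpace ℝ κ :=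
    WithLp.toLp 2 fun s => WithLp.toLp 2 (W *ᵥ Z s + u s)
  ext k
  let direction : PiLp 2 fun _ : S => EuclideanSpace ℝ κ :=
    WithLp.toLp 2 fun s => WithLp.toLp 2 (Pi.single a (Z s k))
  have hline (r : ℝ) : residual W + r • direction = residual (W + single a k r) := by
    ext s b
    simp [residual, direction, add_mulVec, single_mulVec, Function.update_apply]
    ring
  have hinner : ⟪residual W, direction⟫_ℝ = 0 := by
    refine inner_eq_zero_of_eventually_norm_le (.of_forall fun r => ?_)
    rw [hline, ← sq_le_sq₀ (norm_nonneg _) (norm_nonneg _), PiLp.norm_sq_eq_of_L2,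
      PiLp.norm_sq_eq_of_L2]
    exact hW _
  simpa [residual, direction, PiLp.inner_apply, mulVec, dotProduct, mul_comm] using hinner

variable [DecidableEq ι]

/-- The matrix `(Zᵀ Z)⁻¹ Zᵀ`, which maps the observations of a linear regression with the design
matrix `Z` to the least-squares coefficients. -/
noncomputable def leastSquaresMatrix (Z : Matrix S ι ℝ) : Matrix ι S ℝ := (Zᵀ * Z)⁻¹ * Zᵀ

theorem isUnit_transpose_mul_self (hc : 0 < c)
    (hZ : ∀ v, c * (v ⬝ᵥ v) ≤ (Z *ᵥ v) ⬝ᵥ (Z *ᵥ v)) : IsUnit (Zᵀ * Z) := by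
  refine mulVec_injective_iff_isUnit.1 <|
    (injective_iff_map_eq_zero (Zᵀ * Z).mulVecLin).2 fun v hv => dotProduct_self_eq_zero.1 ?_
  have hZv : (Z *ᵥ v) ⬝ᵥ (Z *ᵥ v) = 0 := by
    rw [dotProduct_mulVec, vecMul_mulVec, ← dotProduct_mulVec, ← mulVecLin_apply, hv,
      dotProduct_zero]
  nlinarith [hZ v, dotProduct_self_nonneg v]

theorem eq_neg_leastSquaresMatrix_mulVec (hZ : IsUnit (Zᵀ * Z)) {b : ι → ℝ} {ν : S → ℝ}
    (h : Zᵀ *ᵥ (Z *ᵥ b + ν) = 0) : b = -(leastSquaresMatrix Z *ᵥ ν) := by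
  rw [mulVec_add, mulVec_mulVec, add_eq_zero_iff_eq_neg] at h
  calc b = (Zᵀ * Z)⁻¹ *ᵥ ((Zᵀ * Z) *ᵥ b) := by
        rw [mulVec_mulVec, nonsing_inv_mul _ ((isUnit_iff_isUnit_det _).1 hZ), one_mulVec]
    _ = -(leastSquaresMatrix Z *ᵥ ν) := by rw [h, mulVec_neg, mulVec_mulVec, leastSquaresMatrix]

theorem mul_leastSquaresMatrix_dotProduct_self_le_one (hc : 0 < c)
    (hZ : ∀ v, c * (v ⬝ᵥ v) ≤ (Z *ᵥ v) ⬝ᵥ (Z *ᵥ v)) (k : ι) :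
    c * (leastSquaresMatrix Z k ⬝ᵥ leastSquaresMatrix Z k) ≤ 1 := by
  set v := (Zᵀ * Z)⁻¹ *ᵥ Pi.single k 1 with hv
  have hrow : leastSquaresMatrix Z k = Z *ᵥ v := by
    have hsymm : (leastSquaresMatrix Z)ᵀ = Z * (Zᵀ * Z)⁻¹ := by
      simp [leastSquaresMatrix, transpose_nonsing_inv]
    rw [hv, mulVec_mulVec, ← hsymm, mulVec_single_one]
    rfl
  have hself : (Z *ᵥ v) ⬝ᵥ (Z *ᵥ v) = v k := by
    have hunit := (isUnit_iff_isUnit_det _).1 (isUnit_transpose_mul_self hc hZ)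
    rw [dotProduct_mulVec, vecMul_mulVec, ← dotProduct_mulVec, hv,
      mulVec_mulVec _ (Zᵀ * Z), mul_nonsing_inv _ hunit, one_mulVec, dotProduct_single_one]
  have hvk : v k * v k ≤ v ⬝ᵥ v :=
    Finset.single_le_sum (f := fun j => v j * v j) (fun _ _ => mul_self_nonneg _)
      (Finset.mem_univ k)
  have hle : c * (v k * v k) ≤ v k := (by gcongr : _ ≤ c * (v ⬝ᵥ v)).trans ((hZ v).trans_eq hself)
  rw [hrow, hself]
  by_contra! h
  nlinarith

theorem measurable_leastSquaresMatrix_apply (k : ι) (s : S) :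
    Measurable fun Z : S → ι → ℝ => leastSquaresMatrix (Matrix.of Z) k s := by
  have hZ : Continuous fun Z : S → ι → ℝ => Matrix.of Z := continuous_id
  have hgram : Continuous fun Z : S → ι → ℝ => (Matrix.of Z)ᵀ * Matrix.of Z :=
    hZ.matrix_transpose.matrix_mul hZ
  simp only [leastSquaresMatrix, Matrix.inv_def, Ring.inverse_eq_inv', Matrix.smul_mul,
    Matrix.smul_apply, smul_eq_mul]
  exact hgram.matrix_det.measurable.inv.mul
    ((hgram.matrix_adjugate.matrix_mul hZ.matrix_transpose).matrix_elem k s).measurable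

end LeastSquaresMatrix

section Regression

open scoped Matrix.Norms.Frobenius

theorem frobenius_norm_le_of_abs_le {m n : Type*} [Fintype m] [Fintype n] {A : Matrix m n ℝ} {η : ℝ}
    (hη : 0 ≤ η) (hA : ∀ a b, |A a b| ≤ η) :
    ‖A‖ ≤ √(Fintype.card m * Fintype.card n) * η := by
  have hsum : ∑ a, ∑ b, A a b ^ 2 ≤ ∑ _a : m, ∑ _b : n, η ^ 2 := by
    refine Finset.sum_le_sum fun a _ => Finset.sum_le_sum fun b _ => ?_
    exact sq_le_sq.2 ((hA a b).trans (le_abs_self η))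
  rw [frobenius_norm_def, ← Real.sqrt_eq_rpow, ← Real.sqrt_sq hη, ← Real.sqrt_mul (by positivity)]
  refine Real.sqrt_le_sqrt ?_
  simpa [mul_assoc] using hsum

variable {nx nu n : ℕ} {x : Fin n → Fin nx → ℝ} {ν : Fin n → Fin nu → ℝ}
  {K K' : Matrix (Fin nu) (Fin nx) ℝ} {α α' : Fin nu → ℝ}

/-- The regressors `(x, 1)` of an affine regression on the state `x`. -/
def regressor (x : Fin nx → ℝ) : Fin nx ⊕ Unit → ℝ := Sum.elim x fun _ => 1

/-- The coefficient matrix `[K, α]` of the affine map `x ↦ K x + α`. -/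
def affineCoeff (K : Matrix (Fin nu) (Fin nx) ℝ) (α : Fin nu → ℝ) :
    Matrix (Fin nu) (Fin nx ⊕ Unit) ℝ :=
  fromCols K (replicateCol Unit α)

/-- The design matrix of the affine regression on the states `x s`. -/
def designMatrix (x : Fin n → Fin nx → ℝ) : Matrix (Fin n) (Fin nx ⊕ Unit) ℝ :=
  Matrix.of fun s => regressor (x s)

theorem designMatrix_row (x : Fin n → Fin nx → ℝ) (s : Fin n) :
    designMatrix x s = regressor (x s) := rfl

theorem one_le_regressor_dotProduct_self (x : Fin nx → ℝ) : 1 ≤ regressor x ⬝ᵥ regressor x := by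
  simpa [regressor, dotProduct] using Finset.sum_nonneg fun a _ => mul_self_nonneg (x a)

theorem affineCoeff_mulVec_regressor (K : Matrix (Fin nu) (Fin nx) ℝ) (α : Fin nu → ℝ)
    (x : Fin nx → ℝ) : affineCoeff K α *ᵥ regressor x = K *ᵥ x + α := by
  rw [affineCoeff, regressor, fromCols_mulVec_sumElim]
  congr 1
  ext a
  simp [mulVec, dotProduct]

theorem IsRegression.affineCoeff_sub_apply
    (h : IsRegression x (fun s => -(K *ᵥ x s) - α + ν s) K' α')
    (hx : IsUnit ((designMatrix x)ᵀ * designMatrix x)) (a : Fin nu) :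
    (affineCoeff K' α' - affineCoeff K α) a
      = -(leastSquaresMatrix (designMatrix x) *ᵥ fun s => ν s a) := by
  have hresidual (W : Matrix (Fin nu) (Fin nx ⊕ Unit) ℝ) (s : Fin n) :
      W *ᵥ regressor (x s) + ν s
        = (W + affineCoeff K α) *ᵥ regressor (x s) + (-(K *ᵥ x s) - α + ν s) := by
    rw [add_mulVec, affineCoeff_mulVec_regressor]
    abel
  refine eq_neg_leastSquaresMatrix_mulVec hx (transpose_mulVec_residual_eq_zero (fun W => ?_) a)
  have hW : affineCoeff (W + affineCoeff K α).toCols₁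
      (fun b => (W + affineCoeff K α).toCols₂ b ()) = W + affineCoeff K α := fromCols_toCols _
  have hle := h (W + affineCoeff K α).toCols₁ fun b => (W + affineCoeff K α).toCols₂ b ()
  simp only [← affineCoeff_mulVec_regressor, hW] at hle
  simpa only [designMatrix_row, hresidual, sub_add_cancel] using hle

theorem IsRegression.exists_le_abs_sum_leastSquaresMatrix_mul
    {M : Matrix (Fin nx ⊕ Unit) (Fin nx ⊕ Unit) ℝ} {c ε : ℝ}
    (h : IsRegression x (fun s => -(K *ᵥ x s) - α + ν s) K' α') (hn : 0 < n) (hc : 0 < c)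
    (hM : ∀ v, c * (v ⬝ᵥ v) ≤ v ⬝ᵥ M *ᵥ v)
    (hclose : ∀ p q, |∑ s, normalizedGram (regressor (x s)) p q - n * M p q|
      ≤ n * (c / (2 * (nx + 1))))
    (hε : 0 < ε) (herr : ε < ‖affineCoeff K' α' - affineCoeff K α‖) :
    ∃ a k, n * c / 2 * ∑ s, leastSquaresMatrix (designMatrix x) k s ^ 2 ≤ 1 ∧
      ε / (√(nu * (nx + 1)) + 1)
        ≤ |∑ s, leastSquaresMatrix (designMatrix x) k s * ν s a| := by
  have hZ (v : Fin nx ⊕ Unit → ℝ) :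
      n * c / 2 * (v ⬝ᵥ v) ≤ (designMatrix x *ᵥ v) ⬝ᵥ (designMatrix x *ᵥ v) := by
    have hv := mul_dotProduct_self_le_of_normalizedGram_close (Z := designMatrix x)
      (κ := c / (2 * (nx + 1))) (fun s => one_le_regressor_dotProduct_self (x s)) hM (by positivity)
      (by simpa only [designMatrix_row, Fintype.card_fin] using hclose) v
    have hcard : (n * c / 2 : ℝ) = n * (c - c / (2 * (nx + 1)) * (nx + 1)) := by
      field_simp
      ring
    simpa [hcard] using hv
  have hpos : 0 < n * c / 2 := by positivity
  contrapose! herr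
  have hentry (a : Fin nu) (k : Fin nx ⊕ Unit) :
      |(affineCoeff K' α' - affineCoeff K α) a k| ≤ ε / (√(nu * (nx + 1)) + 1) := by
    rw [h.affineCoeff_sub_apply (isUnit_transpose_mul_self hpos hZ), Pi.neg_apply, abs_neg]
    refine (herr a k ?_).le
    simpa [dotProduct, sq] using mul_leastSquaresMatrix_dotProduct_self_le_one hpos hZ k
  calc ‖affineCoeff K' α' - affineCoeff K α‖
      ≤ √(nu * (nx + 1)) * (ε / (√(nu * (nx + 1)) + 1)) := by
        simpa using frobenius_norm_le_of_abs_le (by positivity) hentry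
    _ ≤ (√(nu * (nx + 1)) + 1) * (ε / (√(nu * (nx + 1)) + 1)) := by gcongr; linarith
    _ = ε := mul_div_cancel₀ _ (by positivity)

end Regression

section StateLaw

variable {N nx nu T t : ℕ} {dyn : LinearDynamics N nx nu} {pol : AffinePolicy N nx nu}
  {μ₀ : EuclideanSpace ℝ (Fin nx)} {χ₀ : Matrix (Fin nx) (Fin nx) ℝ}
  {Sig : ℕ → Matrix (Fin nx) (Fin nx) ℝ}

/-- Initial states and system noises of one demonstration over the horizon `T`. -/
abbrev NoiseSpace (T nx : ℕ) : Type :=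
  EuclideanSpace ℝ (Fin nx) × (Fin T → EuclideanSpace ℝ (Fin nx))

/-- The joint law of the initial state and the system noise of one demonstration. -/
noncomputable def noiseLaw (T : ℕ) (μ₀ : EuclideanSpace ℝ (Fin nx))
    (χ₀ : Matrix (Fin nx) (Fin nx) ℝ) (Sig : ℕ → Matrix (Fin nx) (Fin nx) ℝ) :
    Measure (NoiseSpace T nx) :=
  (multivariateGaussian μ₀ χ₀).prod (Measure.pi fun t : Fin T => multivariateGaussian 0 (Sig t))

instance isProbabilityMeasure_noiseLaw : IsProbabilityMeasure (noiseLaw T μ₀ χ₀ Sig) := by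
  unfold noiseLaw
  infer_instance

/-- The state at the stage `t` as a function of the initial state and the system noise, which is set
to zero after the horizon. -/
noncomputable def stateFun (dyn : LinearDynamics N nx nu) (pol : AffinePolicy N nx nu) (t : ℕ)
    (y : NoiseSpace T nx) : Fin nx → ℝ :=
  stateTraj dyn pol y.1.ofLp (fun r => if h : r < T then (y.2 ⟨r, h⟩).ofLp else 0) t

theorem stateTraj_succ (dyn : LinearDynamics N nx nu) (pol : AffinePolicy N nx nu)
    (x₀ : Fin nx → ℝ) (w : ℕ → Fin nx → ℝ) (t : ℕ) :
    stateTraj dyn pol x₀ w (t + 1)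
      = closedLoop dyn pol t *ᵥ stateTraj dyn pol x₀ w t - drift dyn pol t + w t := by
  rw [stateTraj, closedLoop, drift, sub_mulVec, sum_mulVec]
  simp only [mulVec_sub, mulVec_neg, mulVec_mulVec, Finset.sum_sub_distrib, Finset.sum_neg_distrib]
  abel

theorem stateTraj_congr {x₀ : Fin nx → ℝ} {w w' : ℕ → Fin nx → ℝ} (h : ∀ r < t, w r = w' r) :
    stateTraj dyn pol x₀ w t = stateTraj dyn pol x₀ w' t := by
  induction t with
  | zero => rfl
  | succ t ih => rw [stateTraj_succ, stateTraj_succ, ih fun r hr => h r (by omega), h t (by omega)]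

theorem demoState_eq_stateFun {Ω : Type*} {n : ℕ} (x₀ : Fin n → Ω → EuclideanSpace ℝ (Fin nx))
    (w : Fin n → ℕ → Ω → EuclideanSpace ℝ (Fin nx)) (ω : Ω) (ht : t ≤ T) (s : Fin n) :
    demoState dyn pol x₀ w ω t s
      = stateFun dyn pol t ((x₀ s ω, fun r : Fin T => w s r ω) : NoiseSpace T nx) :=
  stateTraj_congr fun r hr => by rw [dif_pos (by omega)]

theorem continuous_stateFun (t : ℕ) :
    Continuous (stateFun dyn pol t : NoiseSpace T nx → Fin nx → ℝ) := by
  induction t with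
  | zero => exact (PiLp.continuous_ofLp 2 _).comp continuous_fst
  | succ t ih =>
    have hsucc : (stateFun dyn pol (t + 1) : NoiseSpace T nx → Fin nx → ℝ) = fun y =>
        closedLoop dyn pol t *ᵥ stateFun dyn pol t y - drift dyn pol t
          + (if h : t < T then (y.2 ⟨t, h⟩).ofLp else 0) :=
      funext fun y => stateTraj_succ _ _ _ _ _
    rw [hsucc]
    split_ifs <;> fun_prop

theorem measurable_regressor_stateFun (t : ℕ) :
    Measurable fun y : NoiseSpace T nx => regressor (stateFun dyn pol t y) := by
  refine measurable_pi_iff.2 (Sum.rec (fun a => ?_) fun _ => measurable_const)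
  exact ((continuous_apply a).comp (continuous_stateFun t)).measurable

theorem exists_stateTraj_eq_mulVec_add (hF : ∀ t < T, IsUnit (closedLoop dyn pol t)) (ht : t ≤ T) :
    ∃ Φ : Matrix (Fin nx) (Fin nx) ℝ, IsUnit Φ ∧ ∀ w : ℕ → Fin nx → ℝ, ∃ b : Fin nx → ℝ,
      ∀ x₀ : Fin nx → ℝ, stateTraj dyn pol x₀ w t = Φ *ᵥ x₀ + b := by
  induction t with
  | zero => exact ⟨1, isUnit_one, fun w => ⟨0, fun x₀ => by simp [stateTraj]⟩⟩
  | succ t ih =>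
    obtain ⟨Φ, hΦ, haffine⟩ := ih (by omega)
    refine ⟨closedLoop dyn pol t * Φ, (hF t ht).mul hΦ, fun w => ?_⟩
    obtain ⟨b, hb⟩ := haffine w
    refine ⟨closedLoop dyn pol t *ᵥ b - drift dyn pol t + w t, fun x₀ => ?_⟩
    rw [stateTraj_succ, hb, mulVec_add, mulVec_mulVec]
    abel

theorem eq_zero_of_ae_dotProduct_eq_const (hχ : χ₀.PosDef) {u : Fin nx → ℝ} {k : ℝ}
    (h : ∀ᵐ x ∂multivariateGaussian μ₀ χ₀, u ⬝ᵥ x.ofLp = k) : u = 0 := by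
  have hvar : Var[fun x => ⟪WithLp.toLp 2 u, x⟫_ℝ; multivariateGaussian μ₀ χ₀] = 0 := by
    have hconst : (fun x => ⟪WithLp.toLp 2 u, x⟫_ℝ) =ᵐ[multivariateGaussian μ₀ χ₀] fun _ => k := by
      filter_upwards [h] with x hx
      rw [← hx, EuclideanSpace.inner_eq_star_dotProduct, star_trivial, dotProduct_comm]
    rw [variance_congr hconst]
    simp [variance, evariance]
  rw [← covarianceBilin_self IsGaussian.memLp_two_id,
    covarianceBilin_multivariateGaussian hχ.posSemidef] at hvar
  by_contra hu
  exact (by simpa using hχ.dotProduct_mulVec_pos hu : 0 < u ⬝ᵥ χ₀ *ᵥ u).ne' hvar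

theorem eq_zero_of_ae_regressor_stateFun_dotProduct_eq_zero
    (hF : ∀ t < T, IsUnit (closedLoop dyn pol t)) (hχ : χ₀.PosDef) (ht : t ≤ T)
    (v : Fin nx ⊕ Unit → ℝ)
    (h : ∀ᵐ y ∂noiseLaw T μ₀ χ₀ Sig, regressor (stateFun dyn pol t y) ⬝ᵥ v = 0) : v = 0 := by
  obtain ⟨Φ, hΦ, haffine⟩ := exists_stateTraj_eq_mulVec_add hF ht
  set u : Fin nx → ℝ := fun a => v (Sum.inl a) with hu
  have hform (y : NoiseSpace T nx) :
      regressor (stateFun dyn pol t y) ⬝ᵥ v = u ⬝ᵥ stateFun dyn pol t y + v (Sum.inr ()) := by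
    simp [regressor, dotProduct, hu, mul_comm]
  have hmeas : Measurable fun y : NoiseSpace T nx => regressor (stateFun dyn pol t y) ⬝ᵥ v :=
    ((continuous_id.dotProduct continuous_const).measurable).comp (measurable_regressor_stateFun t)
  have hslope : u = 0 := by
    have hzero := measurableSet_eq_fun hmeas (measurable_const (a := (0 : ℝ)))
    obtain ⟨w, hw⟩ := ((Measure.ae_ae_comm
      (p := fun x w => regressor (stateFun dyn pol t (x, w)) ⬝ᵥ v = 0) hzero).1
        (Measure.ae_ae_of_ae_prod h)).exists
    obtain ⟨b, hb⟩ := haffine fun r => if h : r < T then (w ⟨r, h⟩).ofLp else 0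
    have huΦ : u ᵥ* Φ = 0 := by
      refine eq_zero_of_ae_dotProduct_eq_const (μ₀ := μ₀) hχ (k := -(u ⬝ᵥ b) - v (Sum.inr ())) ?_
      filter_upwards [hw] with x hx
      rw [hform, stateFun, hb, dotProduct_add, dotProduct_mulVec] at hx
      linarith
    exact vecMul_injective_of_isUnit hΦ (huΦ.trans (zero_vecMul Φ).symm)
  obtain ⟨y, hy⟩ := h.exists
  rw [hform, hslope, zero_dotProduct, zero_add] at hy
  exact funext (Sum.rec (congrFun hslope) fun _ => hy)

theorem exists_pos_mul_dotProduct_self_le_meanNormalizedGram_regressor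
    (hF : ∀ t < T, IsUnit (closedLoop dyn pol t)) (hχ : χ₀.PosDef) :
    ∃ c > 0, ∀ t < T, ∀ v, c * (v ⬝ᵥ v) ≤ v ⬝ᵥ meanNormalizedGram (noiseLaw T μ₀ χ₀ Sig)
      (fun y => regressor (stateFun dyn pol t y)) *ᵥ v := by
  have hstage (t : Fin T) : ∀ᶠ c in 𝓝[>] (0 : ℝ), ∀ v, c * (v ⬝ᵥ v) ≤
      v ⬝ᵥ meanNormalizedGram (noiseLaw T μ₀ χ₀ Sig)
        (fun y => regressor (stateFun dyn pol t y)) *ᵥ v := by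
    obtain ⟨c, hc, hle⟩ := exists_pos_mul_dotProduct_self_le_meanNormalizedGram
      (ρ := noiseLaw T μ₀ χ₀ Sig) (measurable_regressor_stateFun t)
      (eq_zero_of_ae_regressor_stateFun_dotProduct_eq_zero hF hχ t.2.le)
    filter_upwards [Ioc_mem_nhdsGT hc] with c' hc' v
    exact (mul_le_mul_of_nonneg_right hc'.2 (dotProduct_self_nonneg v)).trans (hle v)
  obtain ⟨c, hc, hpos⟩ := ((eventually_all.2 hstage).and self_mem_nhdsWithin).exists
  exact ⟨c, hpos, fun t ht => hc ⟨t, ht⟩⟩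

end StateLaw

section Demonstrations

variable {N nx nu T t n : ℕ} {dyn : LinearDynamics N nx nu} {pol : AffinePolicy N nx nu}
  {μ₀ : EuclideanSpace ℝ (Fin nx)} {χ₀ : Matrix (Fin nx) (Fin nx) ℝ}
  {Sig : ℕ → Matrix (Fin nx) (Fin nx) ℝ} {σ2 : ℝ≥0} {Ω : Type*} [MeasurableSpace Ω] {P : Measure Ω}
  {x₀ : Fin n → Ω → EuclideanSpace ℝ (Fin nx)} {w : Fin n → ℕ → Ω → EuclideanSpace ℝ (Fin nx)}
  {ν : Fin n → ℕ → Fin N → Ω → Fin nu → ℝ}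

namespace DemonstrationNoise

theorem hasLaw_noise [IsFiniteMeasure P] (h : DemonstrationNoise P T n μ₀ χ₀ Sig σ2 x₀ w ν)
    (s : Fin n) :
    HasLaw (fun ω => (x₀ s ω, fun r : Fin T => w s r ω)) (noiseLaw T μ₀ χ₀ Sig) P :=
  (h.indep_init s).hasLaw_prod (h.law_init s)
    ((h.indep_noise s).hasLaw_pi fun r => h.law_noise s r r.2)

variable [IsProbabilityMeasure P]

theorem measureReal_normalizedGram_deviation_le
    (h : DemonstrationNoise P T n μ₀ χ₀ Sig σ2 x₀ w ν) (ht : t ≤ T) (hn : 0 < n)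
    (p q : Fin nx ⊕ Unit) {κ : ℝ} (hκ : 0 ≤ κ) :
    P.real {ω | n * κ ≤ |∑ s, normalizedGram (regressor (demoState dyn pol x₀ w ω t s)) p q
        - n * meanNormalizedGram (noiseLaw T μ₀ χ₀ Sig)
          (fun y => regressor (stateFun dyn pol t y)) p q|}
      ≤ 2 * Real.exp (-(n * (κ ^ 2 / 2))) := by
  let G (y : NoiseSpace T nx) : ℝ := normalizedGram (regressor (stateFun dyn pol t y)) p q
  have hG : Measurable G :=
    (measurable_normalizedGram_apply p q).comp (measurable_regressor_stateFun t)
  simp only [demoState_eq_stateFun x₀ w _ ht]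
  exact measureReal_le_abs_sum_sub_le_of_abs_le_one
    (X := fun s ω => G (x₀ s ω, fun r : Fin T => w s r ω))
    (h.indep_samples.comp (fun _ d => G (d.1, d.2.1)) fun _ =>
      hG.comp (measurable_fst.prodMk (measurable_fst.comp measurable_snd)))
    (fun s => hG.comp_aemeasurable (h.hasLaw_noise s).aemeasurable)
    (fun s ω => abs_normalizedGram_le_one _ _ _)
    (fun s => (h.hasLaw_noise s).integral_comp hG.aestronglyMeasurable) hn hκ

theorem indepFun_noise_obs (h : DemonstrationNoise P T n μ₀ χ₀ Sig σ2 x₀ w ν) :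
    IndepFun (fun ω s => (x₀ s ω, fun r : Fin T => w s r ω))
      (fun ω s => fun (r : Fin T) (i : Fin N) => ν s r i ω) P :=
  indepFun_pi_of_iIndepFun_prodMk
    (h.indep_samples.comp (fun _ d => ((d.1, d.2.1), d.2.2)) fun _ => by fun_prop)
    (fun s => (h.indep_obs s).symm) (fun s => (h.hasLaw_noise s).aemeasurable)
    fun s => (measurable_pi_lambda _ fun (r : Fin T) => measurable_pi_lambda _ fun i =>
      h.measurable_obs s r r.2 i).aemeasurable

theorem measureReal_leastSquares_deviation_le (h : DemonstrationNoise P T n μ₀ χ₀ Sig σ2 x₀ w ν)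
    (ht : t < T) (i : Fin N) (a : Fin nu) (k : Fin nx ⊕ Unit) {b η : ℝ} (hb : 0 < b)
    (hη : 0 ≤ η) :
    P.real {ω | (∑ s, leastSquaresMatrix (designMatrix (demoState dyn pol x₀ w ω t)) k s ^ 2) * σ2
        ≤ b ∧ η ≤ |∑ s, leastSquaresMatrix (designMatrix (demoState dyn pol x₀ w ω t)) k s
          * ν s t i ω a|}
      ≤ 2 * Real.exp (-η ^ 2 / (2 * b)) := by
  let L (y : Fin n → NoiseSpace T nx) (s : Fin n) : ℝ :=
    leastSquaresMatrix (designMatrix fun s => stateFun dyn pol t (y s)) k s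
  have hL : Measurable L := measurable_pi_lambda _ fun s =>
    (measurable_leastSquaresMatrix_apply k s).comp <| measurable_pi_lambda _ fun s =>
      (measurable_regressor_stateFun t).comp (measurable_pi_apply s)
  have hstate (ω : Ω) : demoState dyn pol x₀ w ω t
      = fun s => stateFun dyn pol t (x₀ s ω, fun r : Fin T => w s r ω) :=
    funext fun s => demoState_eq_stateFun x₀ w ω ht.le s
  have hLν : IndepFun (fun ω => L fun s => (x₀ s ω, fun r : Fin T => w s r ω))
      (fun ω s => ν s t i ω a) P :=
    h.indepFun_noise_obs.comp (φ := L)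
      (ψ := fun (d : Fin n → Fin T → Fin N → Fin nu → ℝ) s => d s ⟨t, ht⟩ i a) hL (by fun_prop)
  simp only [hstate]
  exact measureReal_le_abs_sum_mul_le_of_hasSubgaussianMGF
    (A := fun s ω => L (fun s => (x₀ s ω, fun r : Fin T => w s r ω)) s)
    (fun s => ((measurable_pi_apply s).comp hL).comp_aemeasurable <|
      aemeasurable_pi_lambda _ fun s => (h.hasLaw_noise s).aemeasurable)
    hLν (h.indep_samples.comp (fun _ d => d.2.2 ⟨t, ht⟩ i a) fun _ => by fun_prop)
    (fun s => h.subgaussian_obs s t ht i a) hb hη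

end DemonstrationNoise

end Demonstrations

section Estimation

theorem HoldsWithProb.mono {Ω : Type*} [MeasurableSpace Ω] {P : Measure Ω} {p q : ℝ}
    {good good' : Ω → Prop} (h : HoldsWithProb P p good) (hqp : q ≤ p)
    (hgood : ∀ ω, good ω → good' ω) : HoldsWithProb P q good' := by
  obtain ⟨E, hE, hp, hall⟩ := h
  exact ⟨E, hE, hqp.trans hp, fun ω hω => hgood ω (hall ω hω)⟩

theorem holdsWithProb_of_measureReal_not_le {Ω : Type*} [MeasurableSpace Ω] {P : Measure Ω}
    [IsProbabilityMeasure P] {good : Ω → Prop} {δ : ℝ} (h : P.real {ω | ¬good ω} ≤ δ) :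
    HoldsWithProb P (1 - δ) good := by
  have hmeas := measurableSet_toMeasurable P {ω | ¬good ω}
  refine ⟨(toMeasurable P {ω | ¬good ω})ᶜ, hmeas.compl, ?_, fun ω hω => ?_⟩
  · rw [probReal_compl_eq_one_sub hmeas, measureReal_def, measure_toMeasurable, ← measureReal_def]
    linarith
  · exact not_not.1 fun hbad => hω (subset_toMeasurable P _ hbad)

theorem exists_pos_mul_exp_neg_mul_log_le (B : ℝ) :
    ∃ m > 0, ∀ p : ℕ, 1 ≤ p → ∀ δ : ℝ, 0 < δ → δ < 1 →
      B * Real.exp (-(m * Real.log (2 * p / δ))) ≤ δ := by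
  obtain ⟨m, hm⟩ := pow_unbounded_of_one_lt B (one_lt_two (α := ℝ))
  refine ⟨(m + 1 : ℕ), by positivity, fun p hp δ hδ hδ1 => ?_⟩
  have hp' : (1 : ℝ) ≤ p := by exact_mod_cast hp
  have hexp : Real.exp (-((m + 1 : ℕ) * Real.log (2 * p / δ))) = (δ / (2 * p)) ^ (m + 1) := by
    rw [← mul_neg, ← Real.log_inv, inv_div, Real.exp_nat_mul, Real.exp_log (by positivity)]
  calc B * Real.exp (-((m + 1 : ℕ) * Real.log (2 * p / δ)))
      ≤ 2 ^ (m + 1) * (δ / 2) ^ (m + 1) := by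
        rw [hexp]
        gcongr
        · exact hm.le.trans (pow_le_pow_right₀ one_le_two m.le_succ)
        · linarith
    _ = δ ^ (m + 1) := by rw [← mul_pow, mul_div_cancel₀ _ two_ne_zero]
    _ ≤ δ := pow_le_of_le_one hδ.le hδ1.le m.succ_ne_zero

variable {N nx nu T n : ℕ} {dyn : LinearDynamics N nx nu} {pol : AffinePolicy N nx nu}
  {μ₀ : EuclideanSpace ℝ (Fin nx)} {χ₀ : Matrix (Fin nx) (Fin nx) ℝ}
  {Sig : ℕ → Matrix (Fin nx) (Fin nx) ℝ} {σ2 : ℝ≥0} {Ω : Type*}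
  {x₀ : Fin n → Ω → EuclideanSpace ℝ (Fin nx)} {w : Fin n → ℕ → Ω → EuclideanSpace ℝ (Fin nx)}
  {ν : Fin n → ℕ → Fin N → Ω → Fin nu → ℝ} {c ε ℓ : ℝ}

/-- The events that can spoil the regressions: a deviation of one entry of a normalized Gram matrix,
or of one coefficient of the noise in a least-squares estimate. -/
abbrev DeviationIdx (N nx nu T : ℕ) : Type :=
  (Fin T × (Fin nx ⊕ Unit) × (Fin nx ⊕ Unit)) ⊕ (Fin T × Fin N × Fin nu × (Fin nx ⊕ Unit))

theorem exists_deviation_of_lt_policyError (hn : 0 < n) (hc : 0 < c)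
    (hM : ∀ t < T, ∀ v, c * (v ⬝ᵥ v) ≤ v ⬝ᵥ meanNormalizedGram (noiseLaw T μ₀ χ₀ Sig)
      (fun y => regressor (stateFun dyn pol t y)) *ᵥ v)
    (hε : 0 < ε) {ω : Ω} {pol' : AffinePolicy N nx nu}
    (hreg : ∀ t < T, ∀ i, IsRegression (demoState dyn pol x₀ w ω t)
      (demoInput dyn pol x₀ w ν ω t i) (pol'.K t i) (pol'.α t i))
    (herr : ∃ t < T, ∃ i, ε < policyError pol' pol t i) :
    (∃ t : Fin T, ∃ p q, n * (c / (2 * (nx + 1)))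
      ≤ |∑ s, normalizedGram (regressor (demoState dyn pol x₀ w ω t s)) p q
        - n * meanNormalizedGram (noiseLaw T μ₀ χ₀ Sig)
          (fun y => regressor (stateFun dyn pol t y)) p q|) ∨
    ∃ t : Fin T, ∃ i a k,
      n * c / 2 * ∑ s, leastSquaresMatrix (designMatrix (demoState dyn pol x₀ w ω t)) k s ^ 2 ≤ 1 ∧
      ε / (√(nu * (nx + 1)) + 1)
        ≤ |∑ s, leastSquaresMatrix (designMatrix (demoState dyn pol x₀ w ω t)) k s
          * ν s t i ω a| := by
  obtain ⟨t, ht, i, hi⟩ := herr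
  refine or_iff_not_imp_left.2 fun hgram => ?_
  push Not at hgram
  exact ⟨⟨t, ht⟩, i, (hreg t ht i).exists_le_abs_sum_leastSquaresMatrix_mul hn hc (hM t ht)
    (fun p q => (hgram ⟨t, ht⟩ p q).le) hε hi⟩

theorem DemonstrationNoise.measureReal_exists_lt_policyError_le [MeasurableSpace Ω] {P : Measure Ω}
    [IsProbabilityMeasure P] {polHat : Ω → AffinePolicy N nx nu}
    (h : DemonstrationNoise P T n μ₀ χ₀ Sig σ2 x₀ w ν) (hn : 0 < n) (hc : 0 < c)
    (hM : ∀ t < T, ∀ v, c * (v ⬝ᵥ v) ≤ v ⬝ᵥ meanNormalizedGram (noiseLaw T μ₀ χ₀ Sig)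
      (fun y => regressor (stateFun dyn pol t y)) *ᵥ v)
    (hreg : ∀ ω, ∀ t < T, ∀ i, IsRegression (demoState dyn pol x₀ w ω t)
      (demoInput dyn pol x₀ w ν ω t i) ((polHat ω).K t i) ((polHat ω).α t i))
    (hε : 0 < ε) (hgram : ℓ ≤ n * ((c / (2 * (nx + 1))) ^ 2 / 2))
    (hcross : ℓ ≤ n * (c / (4 * (σ2 + 1) * (√(nu * (nx + 1)) + 1) ^ 2) * ε ^ 2)) :
    P.real {ω | ∃ t < T, ∃ i, ε < policyError (polHat ω) pol t i}
      ≤ Fintype.card (DeviationIdx N nx nu T) * (2 * Real.exp (-ℓ)) := by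
  let b : ℝ := 2 * (σ2 + 1) / (n * c)
  have hb : 0 < b := by positivity
  let bad : DeviationIdx N nx nu T → Set Ω := Sum.elim
    (fun j => {ω | n * (c / (2 * (nx + 1)))
      ≤ |∑ s, normalizedGram (regressor (demoState dyn pol x₀ w ω j.1 s)) j.2.1 j.2.2
        - n * meanNormalizedGram (noiseLaw T μ₀ χ₀ Sig)
          (fun y => regressor (stateFun dyn pol j.1 y)) j.2.1 j.2.2|})
    fun j => {ω | (∑ s, leastSquaresMatrix
        (designMatrix (demoState dyn pol x₀ w ω j.1)) j.2.2.2 s ^ 2) * σ2 ≤ b ∧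
      ε / (√(nu * (nx + 1)) + 1)
        ≤ |∑ s, leastSquaresMatrix (designMatrix (demoState dyn pol x₀ w ω j.1)) j.2.2.2 s
          * ν s j.1 j.2.1 ω j.2.2.1|}
  refine measureReal_le_card_mul_of_subset_iUnion (bad := bad) (fun ω hω => ?_)
    (Sum.rec (fun ⟨t, p, q⟩ => ?_) fun ⟨t, i, a, k⟩ => ?_)
  · obtain ⟨t, p, q, hdev⟩ | ⟨t, i, a, k, hsq, hdev⟩ :=
      exists_deviation_of_lt_policyError hn hc hM hε (hreg ω) hω
    · exact Set.mem_iUnion.2 ⟨Sum.inl (t, p, q), hdev⟩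
    · refine Set.mem_iUnion.2 ⟨Sum.inr (t, i, a, k), ?_, hdev⟩
      set A := ∑ s, leastSquaresMatrix (designMatrix (demoState dyn pol x₀ w ω t)) k s ^ 2
      have : 0 ≤ A := Finset.sum_nonneg fun s _ => sq_nonneg _
      calc A * σ2 ≤ A * (σ2 + 1) := by gcongr; linarith
        _ = n * c / 2 * A * b := by simp only [b]; field_simp
        _ ≤ b := mul_le_of_le_one_left hb.le hsq
  · refine (h.measureReal_normalizedGram_deviation_le t.2.le hn p q (by positivity)).trans ?_
    gcongr
  · have hrate : -(ε / (√(nu * (nx + 1)) + 1)) ^ 2 / (2 * b)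
        = -(n * (c / (4 * (σ2 + 1) * (√(nu * (nx + 1)) + 1) ^ 2) * ε ^ 2)) := by
      simp only [b]
      field_simp
      ring
    refine (h.measureReal_leastSquares_deviation_le t.2 i a k hb (by positivity)).trans ?_
    rw [hrate]
    gcongr

theorem pos_of_sampleSize_le {c₁ c₂ δ : ℝ} {p : ℕ} (hp : 1 ≤ p) (hc₂ : 0 < c₂) (hδ : 0 < δ)
    (hδ1 : δ < 1) (hn : sampleSize c₁ c₂ p ε δ ≤ n) : 0 < n := by
  have hp' : (1 : ℝ) ≤ p := by exact_mod_cast hp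
  have hlog : 0 < Real.log (2 * p / δ) := Real.log_pos ((one_lt_div hδ).2 (by linarith))
  exact_mod_cast (mul_pos hc₂ hlog).trans_le ((le_max_right _ _).trans hn)

end Estimation

theorem theorem1_general {N nx nu : ℕ} (T : ℕ) (dyn : LinearDynamics N nx nu)
    (pol : AffinePolicy N nx nu)
    (hF : ∀ t < T, IsUnit (closedLoop dyn pol t))
    (μ₀ : EuclideanSpace ℝ (Fin nx)) (χ₀ : Matrix (Fin nx) (Fin nx) ℝ) (hχ : χ₀.PosDef)
    (Sig : ℕ → Matrix (Fin nx) (Fin nx) ℝ) (_hSig : ∀ t < T, (Sig t).PosSemidef)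
    (σ2 : ℝ≥0) (τ : ℝ)
    (θ : ℕ → Fin N → ParamIdx nx nu → ℝ) (hθ : IsIdentified T τ dyn pol θ) :
    ∃ c₁ > 0, ∃ c₂ > 0, ∃ C > 0, ∃ ε₀ > 0,
      ∀ (ε δ : ℝ), 0 < ε → 0 < δ → δ < 1 →
      ∀ n : ℕ, sampleSize c₁ c₂ (nx + 1) ε δ ≤ n →
      ∀ {Ω : Type*} [MeasurableSpace Ω] (P : Measure Ω) [IsProbabilityMeasure P]
        (x₀ : Fin n → Ω → EuclideanSpace ℝ (Fin nx))
        (w : Fin n → ℕ → Ω → EuclideanSpace ℝ (Fin nx))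
        (ν : Fin n → ℕ → Fin N → Ω → Fin nu → ℝ),
      DemonstrationNoise P T n μ₀ χ₀ Sig σ2 x₀ w ν →
      ∀ polHat : Ω → AffinePolicy N nx nu,
      (∀ ω, ∀ t < T, ∀ i, IsRegression (demoState dyn pol x₀ w ω t)
        (demoInput dyn pol x₀ w ν ω t i) ((polHat ω).K t i) ((polHat ω).α t i)) →
      HoldsWithProb P (1 - δ) fun ω =>
        (∀ t < T, ∀ i, policyError (polHat ω) pol t i ≤ ε) ∧
        (ε ≤ ε₀ → ∀ θHat, IsIdentified T τ dyn (polHat ω) θHat →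
          ∀ t, 1 ≤ t → t ≤ T → ∀ i,
            (∀ r, t ≤ r → r ≤ T → SameActiveRank T τ dyn (polHat ω) pol θHat θ r i) →
            ‖WithLp.toLp 2 (θHat t i - θ t i)‖ ≤ C * ε) := by
  obtain ⟨c, hc, hM⟩ := exists_pos_mul_dotProduct_self_le_meanNormalizedGram_regressor
    (μ₀ := μ₀) (Sig := Sig) hF hχ
  obtain ⟨m, hm, htail⟩ :=
    exists_pos_mul_exp_neg_mul_log_le (Fintype.card (DeviationIdx N nx nu T) * 2)
  obtain ⟨C, hC, ε₀, hε₀, hlip⟩ := hθ.exists_norm_sub_le hF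
  set k₁ : ℝ := c / (4 * (σ2 + 1) * (√(nu * (nx + 1)) + 1) ^ 2)
  set k₂ : ℝ := (c / (2 * (nx + 1))) ^ 2 / 2
  have : 0 < k₁ := by positivity
  have hk₂ : 0 < k₂ := by positivity
  refine ⟨m / k₁, by positivity, m / k₂, by positivity, C, hC, ε₀, hε₀, ?_⟩
  intro ε δ hε hδ hδ1 n hn Ω _ P _ x₀ w ν hdemo polHat hreg
  have hn0 : 0 < n := pos_of_sampleSize_le (by omega) (by positivity) hδ hδ1 hn
  obtain ⟨hcross, hgram⟩ := max_le_iff.1 hn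
  rw [div_div, div_mul_eq_mul_div, div_le_iff₀ (by positivity)] at hcross
  rw [div_mul_eq_mul_div, div_le_iff₀ hk₂] at hgram
  have hbad := hdemo.measureReal_exists_lt_policyError_le hn0 hc hM hreg hε hgram hcross
  rw [← mul_assoc] at hbad
  have hgood : HoldsWithProb P (1 - δ) fun ω => ∀ t < T, ∀ i, policyError (polHat ω) pol t i ≤ ε :=
    holdsWithProb_of_measureReal_not_le <| by
      simpa only [not_forall, not_le, exists_prop] using
        hbad.trans (htail (nx + 1) (by omega) δ hδ hδ1)
  exact hgood.mono le_rfl fun ω hω => ⟨hω, fun hεε₀ θHat hθHat =>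
    hlip ε hε hεε₀ (polHat ω) θHat hω hθHat⟩

theorem theorem1 {N nx nu : ℕ} (T : ℕ) (dyn : LinearDynamics N nx nu)
    (pol : AffinePolicy N nx nu)
    (hF : ∀ t < T, IsUnit (closedLoop dyn pol t))
    (μ₀ : EuclideanSpace ℝ (Fin nx)) (χ₀ : Matrix (Fin nx) (Fin nx) ℝ) (hχ : χ₀.PosDef)
    (Sig : ℕ → Matrix (Fin nx) (Fin nx) ℝ) (hSig : ∀ t < T, (Sig t).PosSemidef)
    (σ2 : ℝ≥0) (τ : ℝ) (hτ : 0 < τ)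
    (θ : ℕ → Fin N → ParamIdx nx nu → ℝ) (hθ : IsIdentified T τ dyn pol θ) :
    ∃ c₁ > 0, ∃ c₂ > 0, ∃ C > 0, ∃ ε₀ > 0,
      ∀ (ε δ : ℝ), 0 < ε → 0 < δ → δ < 1 →
      ∀ n : ℕ, sampleSize c₁ c₂ (nx + 1) ε δ ≤ n →
      ∀ {Ω : Type*} [MeasurableSpace Ω] (P : Measure Ω) [IsProbabilityMeasure P]
        (x₀ : Fin n → Ω → EuclideanSpace ℝ (Fin nx))
        (w : Fin n → ℕ → Ω → EuclideanSpace ℝ (Fin nx))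
        (ν : Fin n → ℕ → Fin N → Ω → Fin nu → ℝ),
      DemonstrationNoise P T n μ₀ χ₀ Sig σ2 x₀ w ν →
      ∀ polHat : Ω → AffinePolicy N nx nu,
      (∀ ω, ∀ t < T, ∀ i, IsRegression (demoState dyn pol x₀ w ω t)
        (demoInput dyn pol x₀ w ν ω t i) ((polHat ω).K t i) ((polHat ω).α t i)) →
      (∀ t < T, ∀ i, HoldsWithProb P (1 - δ) fun ω => policyError (polHat ω) pol t i ≤ ε) ∧
      (ε ≤ ε₀ →
        ∀ θHat : Ω → ℕ → Fin N → ParamIdx nx nu → ℝ,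
        (∀ ω, IsIdentified T τ dyn (polHat ω) (θHat ω)) →
        ∀ t, 1 ≤ t → t ≤ T → ∀ i,
          HoldsWithProb P ((1 - δ) ^ (T - t + 1)) fun ω =>
            (∀ r, 1 ≤ r → r ≤ T → ∀ j,
              activeSet τ (θHat ω r j) = activeSet τ (θ r j) ∧
              freeRank τ (matM T dyn (polHat ω) (θHat ω) r j) (θHat ω r j)
                = freeRank τ (matM T dyn pol θ r j) (θ r j)) →
            ‖WithLp.toLp 2 (θHat ω t i - θ t i)‖ ≤ C * ε) := by
  obtain ⟨c₁, hc₁, c₂, hc₂, C, hC, ε₀, hε₀, hmain⟩ :=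
    theorem1_general T dyn pol hF μ₀ χ₀ hχ Sig hSig σ2 τ θ hθ
  refine ⟨c₁, hc₁, c₂, hc₂, C, hC, ε₀, hε₀,
    fun ε δ hε hδ hδ1 n hn Ω _ P _ x₀ w ν hdemo polHat hreg => ?_⟩
  have h := hmain ε δ hε hδ hδ1 n hn P x₀ w ν hdemo polHat hreg
  refine ⟨fun t ht i => h.mono le_rfl fun ω hω => hω.1 t ht i,
    fun hεε₀ θHat hθHat t ht htT i => h.mono ?_ fun ω hω hsame => ?_⟩
  · exact pow_le_of_le_one (by linarith) (by linarith) (T - t).succ_ne_zero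
  · exact hω.2 hεε₀ (θHat ω) (hθHat ω) t ht htT i fun r hr hrT => hsame r (ht.trans hr) hrT i
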